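/- **Model.** Lines in the plane are parametrised by $(\theta,r)\in[0,2\pi)\times(0,\infty)$, the line $\{x\cos\theta+y\sin\theta=r\}$ having direction $\mathbf z_\theta=(-\sin\theta,\cos\theta)$. The streets are the lines of a Poisson line process whose parameters form a Poisson process of intensity $\lambda_L>0$ (times Lebesgue measure) on $[0,2\pi)\times(0,\infty)$, together with the street $L_0$ of the ego radar, the $y$-axis. On the streets (including $L_0$) there are independent homogeneous one-dimensional Poisson processes of vehicles of intensity $\lambda>0$. In a block, each vehicle is active with probability $\delta\in[0,1]$, independently of everything else. The ego radar (the typical point) is at the origin, active, with boresight $(0,1)$. With beamwidth $\Omega\in(0,\pi/2]$, the sector of a radar consists of the points seen from it at an angle less than $\Omega/2$ from its boresight; a radar on a street may point in either direction of the street. A radar interferes with the ego radar if each of the two lies in a sector of the other one; let $\Phi'$ be the set of the active interfering radars. In a given slot, $$\xi=\frac{g\,\sigma_c\,P\,R^{-2\alpha}}{N_0+\sum_{\mathbf w\in\Phi'}\kappa\, g\,P\,h_{\mathbf w}\|\mathbf w\|^{-\alpha}},$$ with $R,\alpha,P,g,\kappa>0$, $N_0\ge 0$, exponential $\sigma_c$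 of mean $\bar\sigma>0$ and exponential $h_{\mathbf w}$ of mean $1$, all independent of each other and of the streets, vehicles and access decisions ($\xi=0$ if the sum is infinite). For a threshold $\gamma>0$ let $P_{\rm d}$ be the conditional probability of $\{\xi\ge\gamma\}$ given the streets, the vehicles and the access decisions. **Claim.** For every integer $l\ge 0$, with $\exp(-\infty)=0$, $$\zeta(l)=\mathbb E[P_{\rm d}^l]=\exp\Big(-\frac{l\gamma N_0}{gP\bar\sigma R^{-2\alpha}}\Big)\cdot\exp\Big(-\delta\lambda\int_0^\infty\big(1-\mathcal T(z)^l\big)\,dz\Big)\cdot\exp\Big(-\lambda_L\int_0^{2\pi}\!\!\int_0^\infty\Big[1-\exp\Big(-\delta\lambda\int_{a}^{b}\big(1-\mathcal T(w(x,z,\theta))^l\big)\,dz\Big)\Big]dr\,d\theta\Big),$$ where $$\mathcal T(\rho)=\frac{R^{-2\alpha}}{R^{-2\alpha}+\frac{\kappa}{\bar\sigma}\,\gamma\,\rho^{-\alpha}},\qquad x=\frac{r}{\sin\theta},\qquad w(x,z,\theta)=\sqrt{x^2+z^2+2xz|\cos\theta|},$$ and the interference interval $(a,b)=(a(\theta,r),b(\theta,r))$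 (positions on the line measured upwards from its intersection $(0,x)$ with $L_0$) is given, with $\psi=\arcsin|\sin\theta|\in[0,\pi/2]$ the angle between the line and $L_0$, by $$a=\frac{x\sin(\psi-\Omega/2)}{\sin(\Omega/2)},\qquad b=\frac{x\sin(\Omega/2)}{\sin(\psi-\Omega/2)}\ \text{ if }\psi>\Omega/2,\qquad b=\infty\ \text{ if }\psi\le\Omega/2,$$ when $x>0$ (the interval being empty if $a\ge b$); and when $x<0$, by $(a,b)=\big(\frac{x\sin(\Omega/2)}{\sin(\psi-\Omega/2)},\infty\big)$ if $\psi<\Omega/2$, and by the empty interval otherwise. The second factor is the probability generating functional of the $\delta\lambda$-thinned Poisson process on the ego street, the third one that of the Poisson line Cox process of the $\delta\lambda$-thinned Poisson processes on the other lines, restricted to the interference intervals. -/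

import Mathlib

open MeasureTheory ProbabilityTheory Set
open scoped ENNReal NNReal

noncomputable section

namespace RadarNetwork

/-! ### Point processes on a measurable space, enumerated by a sequence of random points -/

/-- The number of points of the random sequence `X` that lie in `A`. -/
def pointCount {Ω E : Type*} (X : ℕ → Ω → E) (A : Set E) (ω : Ω) : ℝ≥0∞ :=
  ∑' i, A.indicator (fun _ => (1 : ℝ≥0∞)) (X i ω)

/-- The points `X 0, X 1, …` form a Poisson point process with intensity measure `ν`: the number of
points in a measurable set of finite intensity is Poisson distributed with mean the intensity of the
set, and the numbers of points in disjoint measurable sets are independent. -/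
structure IsPoissonProcess {Ω E : Type*} [MeasurableSpace Ω] [MeasurableSpace E]
    (P : Measure Ω) (X : ℕ → Ω → E) (ν : Measure E) : Prop where
  measurable : ∀ i, Measurable (X i)
  count_law : ∀ A : Set E, MeasurableSet A → ν A ≠ ∞ →
    P.map (pointCount X A) = (poissonMeasure (ν A).toNNReal).map (fun n : ℕ => (n : ℝ≥0∞))
  count_indep : ∀ (n : ℕ) (A : Fin n → Set E), (∀ k, MeasurableSet (A k)) →
    Pairwise (fun j k => Disjoint (A j) (A k)) → iIndepFun (fun k => pointCount X (A k)) P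

/-! ### Planar geometry -/

abbrev Plane : Type := EuclideanSpace ℝ (Fin 2)

/-- The direction `(-sin θ, cos θ)` of the line with parameters `q = (θ, r)`. -/
def lineDir (q : ℝ × ℝ) : Plane := !₂[-Real.sin q.1, Real.cos q.1]

/-- The point of the line `{(x, y) | x cos θ + y sin θ = r}`, `q = (θ, r)`, at signed distance `t`
from the foot of the normal from the origin. -/
def linePoint (q : ℝ × ℝ) (t : ℝ) : Plane :=
  !₂[q.2 * Real.cos q.1 - t * Real.sin q.1, q.2 * Real.sin q.1 + t * Real.cos q.1]

/-- The radar sector of beamwidth `Ω` with the given apex and (unit) boresight direction: the points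
seen from the apex at an angle less than `Ω / 2` from the boresight. -/
def sector (beamwidth : ℝ) (apex boresight : Plane) : Set Plane :=
  {p | Real.cos (beamwidth / 2) * ‖p - apex‖ < inner ℝ (p - apex) boresight}

/-- The ego radar is at the origin, with boresight along the positive `y`-axis. A radar at `w` on the
line `q` (with boresight along the line, in either direction) interferes with it when each of the two
radars lies in a sector of the other one. -/
def Interferes (beamwidth : ℝ) (q : ℝ × ℝ) (w : Plane) : Prop :=
  ((0 : Plane) ∈ sector beamwidth w (lineDir q) ∨
    (0 : Plane) ∈ sector beamwidth w (-lineDir q)) ∧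
  w ∈ sector beamwidth 0 !₂[0, 1]

/-! ### The network -/

/-- The parameters of the network. -/
structure Params where
  /-- intensity of the Poisson line process -/
  lineIntensity : ℝ
  /-- intensity of the vehicles on every street -/
  vehicleIntensity : ℝ
  /-- block access probability -/
  access : ℝ
  /-- half-power beamwidth -/
  beamwidth : ℝ
  /-- distance of the target -/
  R : ℝ
  /-- path-loss exponent -/
  α : ℝ
  /-- transmit power -/
  power : ℝ
  /-- noise power -/
  noise : ℝ
  /-- gain factor of the radar -/
  gain : ℝ
  /-- gain of the interference relative to the signal -/
  crossGain : ℝ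
  /-- mean radar cross-section -/
  meanRCS : ℝ
  /-- detection threshold -/
  threshold : ℝ

/-- The admissible values of the parameters. -/
structure Params.Admissible (p : Params) : Prop where
  lineIntensity_pos : 0 < p.lineIntensity
  vehicleIntensity_pos : 0 < p.vehicleIntensity
  access_mem : p.access ∈ Icc (0 : ℝ) 1
  beamwidth_mem : p.beamwidth ∈ Ioc (0 : ℝ) (Real.pi / 2)
  R_pos : 0 < p.R
  α_pos : 0 < p.α
  power_pos : 0 < p.power
  noise_nonneg : 0 ≤ p.noise
  gain_pos : 0 < p.gain
  crossGain_pos : 0 < p.crossGain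
  meanRCS_pos : 0 < p.meanRCS
  threshold_pos : 0 < p.threshold

/-- The random quantities of the network in one slot of a block. Streets are indexed by `Option ℕ`:
`none` is the street of the ego radar, `some i` is the `i`-th line of the line process. The vehicles
of every street are indexed by `ℕ`. -/
structure Network (Ω : Type*) where
  /-- parameters `(θ, r)` of the lines of the line process -/
  line : ℕ → Ω → ℝ × ℝ
  /-- position of a vehicle on its street -/
  pos : Option ℕ → ℕ → Ω → ℝ
  /-- whether the radar of a vehicle is active in the block -/
  active : Option ℕ → ℕ → Ω → Bool
  /-- fading power of the signal of an interfering radar -/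
  fading : Option ℕ → ℕ → Ω → ℝ
  /-- radar cross-section of the target -/
  rcs : Ω → ℝ

/-- The independent sources of randomness. -/
inductive Source : Type
  | lines
  | vehicles (k : Option ℕ)
  | access (k : Option ℕ) (j : ℕ)
  | fading (k : Option ℕ) (j : ℕ)
  | rcs

variable {Ω : Type*}

namespace Network

/-- The σ-algebra generated by a source of randomness. -/
@[reducible] def sourceAlgebra (N : Network Ω) : Source → MeasurableSpace Ω
  | .lines => MeasurableSpace.comap (fun ω i => N.line i ω) inferInstance
  | .vehicles k => MeasurableSpace.comap (fun ω j => N.pos k j ω) inferInstance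
  | .access k j => MeasurableSpace.comap (N.active k j) inferInstance
  | .fading k j => MeasurableSpace.comap (N.fading k j) inferInstance
  | .rcs => MeasurableSpace.comap N.rcs inferInstance

/-- The law of the network, seen from the typical (ego) radar at the origin: a Poisson line process
on `[0, 2π) × (0, ∞)`, independent Poisson processes of vehicles on its lines and on the additional
street through the ego radar, independent access decisions, exponential (Rayleigh) fading powers of
mean `1`, and an exponential (Swerling-I) cross-section of the target. -/
structure HasNetworkLaw [MeasurableSpace Ω] (N : Network Ω) (P : Measure Ω) (p : Params) :
    Prop where
  lines : IsPoissonProcess P N.line (ENNReal.ofReal p.lineIntensity •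
    (volume : Measure (ℝ × ℝ)).restrict (Ico 0 (2 * Real.pi) ×ˢ Ioi 0))
  vehicles : ∀ k, IsPoissonProcess P (N.pos k)
    (ENNReal.ofReal p.vehicleIntensity • (volume : Measure ℝ))
  active_measurable : ∀ k j, Measurable (N.active k j)
  active_law : ∀ k j, P {ω | N.active k j ω = true} = ENNReal.ofReal p.access
  fading_measurable : ∀ k j, Measurable (N.fading k j)
  fading_law : ∀ k j, P.map (N.fading k j) = expMeasure 1
  rcs_measurable : Measurable N.rcs
  rcs_law : P.map N.rcs = expMeasure (1 / p.meanRCS)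
  indep : iIndep N.sourceAlgebra P

/-- The parameters of a street; the street of the ego radar is the `y`-axis. -/
def street (N : Network Ω) : Option ℕ → Ω → ℝ × ℝ
  | none => fun _ => (0, 0)
  | some i => N.line i

/-- The location in the plane of a vehicle. -/
def location (N : Network Ω) (k : Option ℕ) (j : ℕ) (ω : Ω) : Plane :=
  linePoint (N.street k ω) (N.pos k j ω)

open Classical in
/-- The total interference `∑ κ g P h_w ‖w‖ ^ (-α)` over the active interfering radars. -/
def interference (N : Network Ω) (p : Params) (ω : Ω) : ℝ≥0∞ :=
  ∑' (k : Option ℕ) (j : ℕ),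
    if N.active k j ω = true ∧ Interferes p.beamwidth (N.street k ω) (N.location k j ω) then
      ENNReal.ofReal (p.crossGain * p.gain * p.power * N.fading k j ω) *
        ENNReal.ofReal ‖N.location k j ω‖ ^ (-p.α)
    else 0

/-- The signal to interference and noise ratio at the ego radar (it is `0` when the total interference
is infinite). -/
def sinr (N : Network Ω) (p : Params) (ω : Ω) : ℝ≥0∞ :=
  ENNReal.ofReal (p.gain * N.rcs ω * p.power * p.R ^ (-2 * p.α)) /
    (ENNReal.ofReal p.noise + N.interference p ω)

/-- The σ-algebra of the street geometry, the vehicle locations and the access decisions. -/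
@[reducible] def environment (N : Network Ω) : MeasurableSpace Ω :=
  N.sourceAlgebra .lines ⊔ (⨆ k, N.sourceAlgebra (.vehicles k)) ⊔
    (⨆ k, ⨆ j, N.sourceAlgebra (.access k j))

/-- The conditional probability of successful detection, given the streets, the vehicles and the
access decisions. -/
def detectionProb [MeasurableSpace Ω] (N : Network Ω) (P : Measure Ω) (p : Params) : Ω → ℝ :=
  P[{ω | ENNReal.ofReal p.threshold ≤ N.sinr p ω}.indicator (fun _ => (1 : ℝ)) | N.environment]

/-- The moments of the conditional detection probability. -/
def moment [MeasurableSpace Ω] (N : Network Ω) (P : Measure Ω) (p : Params) (l : ℕ) : ℝ :=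
  ∫ ω, N.detectionProb P p ω ^ l ∂P

end Network

/-! ### The quantities in the formula for the moments -/

/-- `exp (-x)` for `x ∈ [0, ∞]`, with `exp (-∞) = 0`. -/
def expNeg (x : ℝ≥0∞) : ℝ := if x = ∞ then 0 else Real.exp (-x.toReal)

/-- The factor contributed by an active interfering radar at distance `ρ`. -/
def transmission (p : Params) (ρ : ℝ) : ℝ :=
  p.R ^ (-2 * p.α) /
    (p.R ^ (-2 * p.α) + p.crossGain / p.meanRCS * p.threshold * ρ ^ (-p.α))

/-- The ordinate of the intersection of the line `(θ, r)` with the `y`-axis. -/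
def crossing (θ r : ℝ) : ℝ := r / Real.sin θ

/-- The angle in `[0, π / 2]` between the line `(θ, r)` and the `y`-axis. -/
def acuteAngle (θ : ℝ) : ℝ := Real.arcsin |Real.sin θ|

/-- The lower end of the interference interval on the line `(θ, r)`. Positions on a line are measured
from its intersection with the `y`-axis, upwards. -/
def lowerEnd (beamwidth θ r : ℝ) : EReal :=
  if 0 < crossing θ r then
    ((crossing θ r * Real.sin (acuteAngle θ - beamwidth / 2) / Real.sin (beamwidth / 2) : ℝ) : EReal)
  else if acuteAngle θ < beamwidth / 2 then
    ((crossing θ r * Real.sin (beamwidth / 2) / Real.sin (acuteAngle θ - beamwidth / 2) : ℝ) : EReal)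
  else ⊤

/-- The upper end of the interference interval on the line `(θ, r)`. -/
def upperEnd (beamwidth θ r : ℝ) : EReal :=
  if 0 < crossing θ r ∧ beamwidth / 2 < acuteAngle θ then
    ((crossing θ r * Real.sin (beamwidth / 2) / Real.sin (acuteAngle θ - beamwidth / 2) : ℝ) : EReal)
  else ⊤

/-- The interference interval on the line `(θ, r)`. -/
def interferenceInterval (beamwidth θ r : ℝ) : Set ℝ :=
  {z | lowerEnd beamwidth θ r < (z : EReal) ∧ (z : EReal) < upperEnd beamwidth θ r}

/-- The distance from the origin of the point at position `z` on a line that meets the `y`-axis at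
`(0, x)` under the acute angle with cosine `|cos θ|`. -/
def pointDist (x z θ : ℝ) : ℝ := Real.sqrt (x ^ 2 + z ^ 2 + 2 * x * z * |Real.cos θ|)

end RadarNetwork

end

/-!
The moments of the conditional detection probability factor because every source of randomness acts
on exponentials of sums, and these can be averaged one source at a time.

All products are written as `exp (-x)` with `x` a sum in `[0, ∞]` (`expNegENN`, with inverse
`negLog`), so that divergent sums and vanishing products need no separate treatment. For independent
summands the expectation of the exponential is again of this form
(`lintegral_expNegENN_tsum_of_iIndepFun`), and for a Poisson process it is the Laplace functional
`exp (-∫ (1 - exp (-g)) dν)` (`IsPoissonProcess.lintegral_expNegENN_tsum`), obtained from the count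
laws for simple functions and by monotone approximation in general.

Given the streets, vehicles and access decisions, the exponential cross-section exceeds the threshold
times noise plus interference with probability an exponential of that level, and averaging over the
exponential fading powers gives one factor `transmission` for each active interfering radar. Thus the
conditional detection probability is `exp (-detectionExponent)`
(`Network.HasNetworkLaw.detectionProb_ae_eq`), and its power of order `l` is an exponential of the
same kind. Averaging over the access decisions replaces a factor `e` by `1 - δ (1 - e)`, averaging
over the vehicles of a street gives `exp (-streetExponent)`, and averaging over the line process is
once more a Poisson Laplace functional (`Network.HasNetworkLaw.lintegral_expNegENN_active`).

It remains to identify the set of interfering positions on a street. Each of the two sector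
conditions says that a point lies in a cone of half-angle half the beamwidth, which is linear in the
position (`cos_mul_sqrt_lt_iff`). Their intersection is the interference interval
(`mem_interferenceInterval_iff`); the second branch of the cone about the street drops out because
half the beamwidth is at most `π / 4`. The streets with `sin θ = 0`, for which the position of the
crossing is a junk value, form a null set.
-/

noncomputable section

namespace RadarNetwork

open Filter Topology

/-! ### The exponential `exp (-x)` on `[0, ∞]` and its inverse -/

/-- `exp (-x)` for `x ∈ [0, ∞]`, as an extended nonnegative number. -/
def expNegENN (x : ℝ≥0∞) : ℝ≥0∞ := (EReal.exp (x : EReal))⁻¹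

/-- `-log y` for `y ∈ [0, 1]`, with `-log 0 = ∞`; it is truncated to `0` for `y ≥ 1`. -/
def negLog (y : ℝ≥0∞) : ℝ≥0∞ := if y = 0 then ∞ else ENNReal.ofReal (-Real.log y.toReal)

@[simp] lemma expNegENN_zero : expNegENN 0 = 1 := by simp [expNegENN]

@[simp] lemma expNegENN_top : expNegENN ∞ = 0 := by simp [expNegENN]

lemma expNegENN_ofReal {x : ℝ} (hx : 0 ≤ x) :
    expNegENN (ENNReal.ofReal x) = ENNReal.ofReal (Real.exp (-x)) := by
  rw [expNegENN, EReal.coe_ennreal_ofReal, max_eq_left hx, EReal.exp_coe, Real.exp_neg,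
    ENNReal.ofReal_inv_of_pos (Real.exp_pos _)]

lemma expNegENN_eq_ofReal (x : ℝ≥0∞) : expNegENN x = ENNReal.ofReal (expNeg x) := by
  induction x with
  | top => simp [expNeg]
  | coe x =>
    rw [← ENNReal.ofReal_coe_nnreal, expNegENN_ofReal x.coe_nonneg, expNeg,
      if_neg ENNReal.ofReal_ne_top, ENNReal.toReal_ofReal x.coe_nonneg]

lemma expNeg_nonneg (x : ℝ≥0∞) : 0 ≤ expNeg x := by
  unfold expNeg; split_ifs <;> positivity

lemma toReal_expNegENN (x : ℝ≥0∞) : (expNegENN x).toReal = expNeg x := by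
  rw [expNegENN_eq_ofReal, ENNReal.toReal_ofReal (expNeg_nonneg x)]

lemma expNegENN_add (x y : ℝ≥0∞) : expNegENN (x + y) = expNegENN x * expNegENN y := by
  have h (z : ℝ≥0∞) : EReal.exp (z : EReal) ≠ 0 := by simp [EReal.coe_ennreal_ne_bot]
  rw [expNegENN, EReal.coe_ennreal_add, EReal.exp_add, ENNReal.mul_inv (.inl (h x)) (.inr (h y))]
  rfl

lemma expNegENN_sum {ι : Type*} (s : Finset ι) (f : ι → ℝ≥0∞) :
    expNegENN (∑ i ∈ s, f i) = ∏ i ∈ s, expNegENN (f i) := by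
  induction s using Finset.cons_induction with
  | empty => simp
  | cons a s ha ih => rw [Finset.sum_cons, Finset.prod_cons, expNegENN_add, ih]

lemma expNegENN_nat_mul (n : ℕ) (x : ℝ≥0∞) : expNegENN (n * x) = expNegENN x ^ n := by
  simpa using expNegENN_sum (Finset.range n) (fun _ => x)

lemma expNegENN_le_one (x : ℝ≥0∞) : expNegENN x ≤ 1 := by
  simp [expNegENN, EReal.coe_ennreal_nonneg]

lemma expNegENN_ne_top (x : ℝ≥0∞) : expNegENN x ≠ ∞ :=
  ne_top_of_le_ne_top ENNReal.one_ne_top (expNegENN_le_one x)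

lemma antitone_expNegENN : Antitone expNegENN := fun x y h => by
  simpa [expNegENN] using h

@[fun_prop]
lemma continuous_expNegENN : Continuous expNegENN := by
  unfold expNegENN
  exact continuous_inv.comp (ENNReal.continuous_exp.comp continuous_coe_ennreal_ereal)

@[fun_prop]
lemma measurable_expNegENN : Measurable expNegENN := continuous_expNegENN.measurable

@[fun_prop]
lemma measurable_negLog : Measurable negLog := by
  unfold negLog
  exact Measurable.ite (measurableSet_singleton 0) measurable_const (by fun_prop)

lemma expNegENN_negLog {y : ℝ≥0∞} (hy : y ≤ 1) : expNegENN (negLog y) = y := by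
  unfold negLog
  split_ifs with h
  · simp [h]
  · have hy' : y ≠ ∞ := ne_top_of_le_ne_top ENNReal.one_ne_top hy
    have h1 : y.toReal ≤ 1 := by simpa using ENNReal.toReal_mono ENNReal.one_ne_top hy
    have h0 : 0 < y.toReal := ENNReal.toReal_pos h hy'
    rw [expNegENN_ofReal (neg_nonneg.2 (Real.log_nonpos h0.le h1)), neg_neg, Real.exp_log h0,
      ENNReal.ofReal_toReal hy']

lemma negLog_expNegENN (x : ℝ≥0∞) : negLog (expNegENN x) = x := by
  induction x with
  | top => simp [negLog]
  | coe x =>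
    have hx : 0 ≤ (x : ℝ) := x.coe_nonneg
    rw [← ENNReal.ofReal_coe_nnreal, expNegENN_ofReal hx, negLog, if_neg (by simp [Real.exp_pos]),
      ENNReal.toReal_ofReal (Real.exp_pos _).le, Real.log_exp, neg_neg]

/-! ### Exponential functionals of independent variables -/

section Independence

variable {Ω : Type*} [MeasurableSpace Ω] {P : Measure Ω}

lemma lintegral_expNegENN_le_one [IsProbabilityMeasure P] (f : Ω → ℝ≥0∞) :
    ∫⁻ ω, expNegENN (f ω) ∂P ≤ 1 := by
  calc ∫⁻ ω, expNegENN (f ω) ∂P ≤ ∫⁻ _, 1 ∂P := lintegral_mono fun ω => expNegENN_le_one _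
    _ = 1 := by simp

/-- For independent `ξ i` the expectation of the possibly infinite product `∏ exp (-ξ i)` is the
product of the expectations, written as the exponential of a sum of logarithms. -/
lemma lintegral_expNegENN_tsum_of_iIndepFun [IsProbabilityMeasure P] {ι : Type*} [Countable ι]
    {ξ : ι → Ω → ℝ≥0∞} (hm : ∀ i, Measurable (ξ i)) (hi : iIndepFun ξ P) :
    ∫⁻ ω, expNegENN (∑' i, ξ i ω) ∂P =
      expNegENN (∑' i, negLog (∫⁻ ω, expNegENN (ξ i ω) ∂P)) := by
  have h1 : Tendsto (fun s : Finset ι => ∫⁻ ω, expNegENN (∑ i ∈ s, ξ i ω) ∂P) atTop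
      (𝓝 (∫⁻ ω, expNegENN (∑' i, ξ i ω) ∂P)) := by
    refine tendsto_lintegral_filter_of_dominated_convergence (fun _ => 1)
      (.of_forall fun s => by fun_prop) (.of_forall fun s => .of_forall fun ω => expNegENN_le_one _)
      (by simp) (.of_forall fun ω => ?_)
    exact (continuous_expNegENN.tendsto _).comp ENNReal.summable.hasSum
  have h2 : Tendsto (fun s : Finset ι =>
      expNegENN (∑ i ∈ s, negLog (∫⁻ ω, expNegENN (ξ i ω) ∂P))) atTop
      (𝓝 (expNegENN (∑' i, negLog (∫⁻ ω, expNegENN (ξ i ω) ∂P)))) :=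
    (continuous_expNegENN.tendsto _).comp ENNReal.summable.hasSum
  refine tendsto_nhds_unique h1 (h2.congr fun s => ?_)
  have hi' : iIndepFun (fun i ω => expNegENN (ξ i ω)) P :=
    hi.comp (fun _ => expNegENN) fun _ => measurable_expNegENN
  simp_rw [expNegENN_sum]
  rw [lintegral_prod_eq_prod_lintegral_of_indepFun s _ hi' fun i => by fun_prop]
  exact Finset.prod_congr rfl fun i _ => expNegENN_negLog (lintegral_expNegENN_le_one _)

/-- Integration of a function of two independent variables, one variable at a time. -/
lemma lintegral_of_indepFun [IsFiniteMeasure P] {E F : Type*} [MeasurableSpace E]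
    [MeasurableSpace F] {X : Ω → E} {Y : Ω → F} (hX : Measurable X) (hY : Measurable Y)
    (h : IndepFun X Y P) {f : E → F → ℝ≥0∞} (hf : Measurable (Function.uncurry f)) :
    ∫⁻ ω, f (X ω) (Y ω) ∂P = ∫⁻ ω, ∫⁻ ω', f (X ω) (Y ω') ∂P ∂P := by
  have h1 := (indepFun_iff_map_prod_eq_prod_map_map hX.aemeasurable hY.aemeasurable).1 h
  calc ∫⁻ ω, f (X ω) (Y ω) ∂P
      = ∫⁻ z, Function.uncurry f z ∂(P.map fun ω => (X ω, Y ω)) :=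
        (lintegral_map hf (hX.prodMk hY)).symm
    _ = ∫⁻ x, ∫⁻ y, f x y ∂(P.map Y) ∂(P.map X) := by
        rw [h1, lintegral_prod _ hf.aemeasurable]; rfl
    _ = ∫⁻ ω, ∫⁻ y, f (X ω) y ∂(P.map Y) ∂P :=
        lintegral_map hf.lintegral_prod_right' hX
    _ = _ := lintegral_congr fun ω => lintegral_map (hf.comp measurable_prodMk_left) hY

end Independence

/-! ### The Laplace functional of a Poisson process -/

section Poisson

variable {Ω E : Type*} [MeasurableSpace Ω] [MeasurableSpace E] {P : Measure Ω}
  {X : ℕ → Ω → E} {ν : Measure E}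

/-- The probability generating function of the Poisson distribution. -/
lemma lintegral_pow_poissonMeasure (r : ℝ≥0) {y : ℝ≥0∞} (hy : y ≤ 1) :
    ∫⁻ n, y ^ n ∂(poissonMeasure r) = expNegENN (r * (1 - y)) := by
  lift y to ℝ≥0 using ne_top_of_le_ne_top ENNReal.one_ne_top hy
  have hy1 : (y : ℝ) ≤ 1 := by exact_mod_cast hy
  have hs : HasSum (fun n : ℕ => Real.exp (-r) * r ^ n / n.factorial * (y : ℝ) ^ n)
      (Real.exp (-(r * (1 - y)))) := by
    have h := (NormedSpace.expSeries_div_hasSum_exp ((r : ℝ) * y)).mul_left (Real.exp (-r))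
    rw [← Real.exp_eq_exp_ℝ, ← Real.exp_add] at h
    convert! h using 1
    · ext n
      simp only [mul_pow]
      ring
    · congr 1
      ring
  have hr : (r : ℝ≥0∞) * (1 - y) = ENNReal.ofReal (r * (1 - y)) := by
    rw [ENNReal.ofReal_mul r.coe_nonneg, ENNReal.ofReal_sub _ y.coe_nonneg]; simp
  rw [hr, expNegENN_ofReal (mul_nonneg r.coe_nonneg (sub_nonneg.2 hy1)), ← hs.tsum_eq,
    ENNReal.ofReal_tsum_of_nonneg (fun n => by positivity) hs.summable,
    lintegral_countable']
  refine tsum_congr fun n => ?_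
  rw [poissonMeasure_singleton, mul_comm, ENNReal.ofReal_mul (by positivity),
    ENNReal.ofReal_pow y.coe_nonneg, ENNReal.ofReal_coe_nnreal]

lemma measurable_pointCount (hX : ∀ i, Measurable (X i)) {A : Set E} (hA : MeasurableSet A) :
    Measurable (pointCount X A) := by
  unfold pointCount
  exact Measurable.tsum fun i => (measurable_const.indicator hA).comp (hX i)

/-- The Laplace transform of the number of points in a set; a set of infinite intensity is allowed
with coefficient `0` only. -/
lemma IsPoissonProcess.lintegral_expNegENN_mul_pointCount [IsProbabilityMeasure P]
    (h : IsPoissonProcess P X ν) {A : Set E} (hA : MeasurableSet A) {c : ℝ≥0∞}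
    (hc : c = 0 ∨ ν A ≠ ∞) :
    ∫⁻ ω, expNegENN (c * pointCount X A ω) ∂P = expNegENN (ν A * (1 - expNegENN c)) := by
  rcases hc with rfl | hν
  · simp
  · have h1 : ∫⁻ ω, expNegENN (c * pointCount X A ω) ∂P =
        ∫⁻ x, expNegENN (c * x) ∂(P.map (pointCount X A)) :=
      (lintegral_map (f := fun x => expNegENN (c * x)) (by fun_prop)
          (measurable_pointCount h.measurable hA)).symm
    rw [h1, h.count_law A hA hν, lintegral_map (by fun_prop) (by fun_prop)]
    simp_rw [mul_comm c, expNegENN_nat_mul]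
    rw [lintegral_pow_poissonMeasure _ (expNegENN_le_one c), ENNReal.coe_toNNReal hν]

/-- The Laplace functional for simple functions whose nonzero level sets have finite intensity. -/
lemma IsPoissonProcess.lintegral_expNegENN_tsum_simpleFunc [IsProbabilityMeasure P]
    (h : IsPoissonProcess P X ν) (g : SimpleFunc E ℝ≥0∞)
    (hg : ∀ c, c ≠ 0 → ν (g ⁻¹' {c}) ≠ ∞) :
    ∫⁻ ω, expNegENN (∑' j, g (X j ω)) ∂P = expNegENN (∫⁻ x, (1 - expNegENN (g x)) ∂ν) := by
  let e := g.range.equivFin.symm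
  let A : Fin g.range.card → Set E := fun k => g ⁻¹' {(e k : ℝ≥0∞)}
  have hA : ∀ k, MeasurableSet (A k) := fun k => g.measurableSet_fiber _
  have hsum (F : ℝ≥0∞ → ℝ≥0∞ → ℝ≥0∞) :
      ∑ k, F (e k) (e k) = ∑ y ∈ g.range, F y y := by
    rw [← Finset.sum_coe_sort g.range (fun y => F y y)]
    exact Equiv.sum_comp e (fun y : g.range => F (y : ℝ≥0∞) (y : ℝ≥0∞))
  have hgsum (x : E) : g x = ∑ k, (e k : ℝ≥0∞) * (A k).indicator (fun _ => 1) x := by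
    rw [hsum fun y z => y * (g ⁻¹' {z}).indicator (fun _ => 1) x,
      Finset.sum_eq_single_of_mem (g x) (g.mem_range_self x)]
    · simp
    · intro y _ hy
      rw [indicator_of_notMem (by simpa using hy.symm), mul_zero]
  have hcount (ω : Ω) : ∑' j, g (X j ω) = ∑' k, (e k : ℝ≥0∞) * pointCount X (A k) ω := by
    simp_rw [hgsum, pointCount, ← ENNReal.tsum_mul_left]
    rw [Summable.tsum_finsetSum fun _ _ => ENNReal.summable, tsum_fintype]
  have hind : iIndepFun (fun k ω => (e k : ℝ≥0∞) * pointCount X (A k) ω) P :=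
    (h.count_indep _ A hA fun j k hjk => by
      refine Disjoint.preimage _ (disjoint_singleton.2 fun hc => hjk ?_)
      exact e.injective (Subtype.ext hc)).comp (fun k x => (e k : ℝ≥0∞) * x) fun k => by fun_prop
  have hmeas := fun k => measurable_pointCount h.measurable (hA k)
  simp_rw [hcount]
  rw [lintegral_expNegENN_tsum_of_iIndepFun (fun k => by fun_prop) hind]
  congr 1
  have hk (k) : negLog (∫⁻ ω, expNegENN (e k * pointCount X (A k) ω) ∂P) =
      (1 - expNegENN (e k)) * ν (A k) := by
    rw [h.lintegral_expNegENN_mul_pointCount (hA k), negLog_expNegENN, mul_comm]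
    by_cases h0 : (e k : ℝ≥0∞) = 0
    · exact .inl h0
    · exact .inr (hg _ h0)
  simp_rw [hk, tsum_fintype]
  rw [hsum fun y z => (1 - expNegENN y) * ν (g ⁻¹' {z})]
  have := SimpleFunc.map_lintegral (μ := ν) (fun y => 1 - expNegENN y) g
  rw [← this, ← SimpleFunc.lintegral_eq_lintegral]
  rfl

/-- The Laplace functional of a Poisson process: `E ∏ exp (-g (X j)) = exp (-∫ (1 - exp (-g)) dν)`.
The value `∞` of `g` is allowed. -/
theorem IsPoissonProcess.lintegral_expNegENN_tsum [IsProbabilityMeasure P] [SigmaFinite ν]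
    (h : IsPoissonProcess P X ν) {g : E → ℝ≥0∞} (hg : Measurable g) :
    ∫⁻ ω, expNegENN (∑' j, g (X j ω)) ∂P = expNegENN (∫⁻ x, (1 - expNegENN (g x)) ∂ν) := by
  -- The cut-off to a set of finite intensity is needed because the count law is known only there.
  let G : ℕ → SimpleFunc E ℝ≥0∞ := fun n =>
    (SimpleFunc.eapprox g n).restrict (spanningSets ν n)
  have hG (n x) : G n x = (spanningSets ν n).indicator (SimpleFunc.eapprox g n) x := by
    rw [SimpleFunc.restrict_apply _ (measurableSet_spanningSets ν n)]
  have hmono (x : E) : Monotone fun n => G n x := fun m n hmn => by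
    simp only [hG]
    exact (indicator_le_indicator_of_subset (monotone_spanningSets ν hmn) (fun _ => zero_le) x).trans
      (indicator_le_indicator (SimpleFunc.monotone_eapprox g hmn x))
  have hlim (x : E) : Tendsto (fun n => G n x) atTop (𝓝 (g x)) := by
    have h1 : Tendsto (fun n => SimpleFunc.eapprox g n x) atTop (𝓝 (g x)) := by
      rw [← SimpleFunc.iSup_eapprox_apply hg x]
      exact tendsto_atTop_iSup fun m n hmn => SimpleFunc.monotone_eapprox g hmn x
    refine h1.congr' ?_
    filter_upwards [eventually_mem_spanningSets ν x] with n hn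
    rw [hG, indicator_of_mem hn]
  have hfin (n : ℕ) (c : ℝ≥0∞) (hc : c ≠ 0) : ν (G n ⁻¹' {c}) ≠ ∞ := by
    refine ne_top_of_le_ne_top (measure_spanningSets_lt_top ν n).ne (measure_mono fun x hx => ?_)
    by_contra hn
    exact hc (by rw [← show G n x = c from hx, hG, indicator_of_notMem hn])
  have hsum (ω : Ω) : Tendsto (fun n => ∑' j, G n (X j ω)) atTop (𝓝 (∑' j, g (X j ω))) := by
    simp_rw [← lintegral_count]
    exact lintegral_tendsto_of_tendsto_of_monotone (fun n => (measurable_of_countable _).aemeasurable)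
      (.of_forall fun j => hmono (X j ω)) (.of_forall fun j => hlim (X j ω))
  have hXm := h.measurable
  have hL : Tendsto (fun n => ∫⁻ ω, expNegENN (∑' j, G n (X j ω)) ∂P) atTop
      (𝓝 (∫⁻ ω, expNegENN (∑' j, g (X j ω)) ∂P)) := by
    refine tendsto_lintegral_filter_of_dominated_convergence (fun _ => 1)
      (.of_forall fun n => ?_) (.of_forall fun n => .of_forall fun ω => expNegENN_le_one _)
      (by simp) (.of_forall fun ω => (continuous_expNegENN.tendsto _).comp (hsum ω))
    exact measurable_expNegENN.comp (Measurable.tsum fun j => (G n).measurable.comp (hXm j))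
  have hR : Tendsto (fun n => expNegENN (∫⁻ x, (1 - expNegENN (G n x)) ∂ν)) atTop
      (𝓝 (expNegENN (∫⁻ x, (1 - expNegENN (g x)) ∂ν))) := by
    refine (continuous_expNegENN.tendsto _).comp (lintegral_tendsto_of_tendsto_of_monotone
      (fun n => ?_) (.of_forall fun x m n hmn => ?_) (.of_forall fun x => ?_))
    · exact (measurable_const.sub (measurable_expNegENN.comp (G n).measurable)).aemeasurable
    · exact tsub_le_tsub_left (antitone_expNegENN (hmono x hmn)) 1
    · exact ENNReal.Tendsto.sub tendsto_const_nhds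
        ((continuous_expNegENN.tendsto _).comp (hlim x)) (.inl ENNReal.one_ne_top)
  refine tendsto_nhds_unique hL (hR.congr fun n => ?_)
  exact (h.lintegral_expNegENN_tsum_simpleFunc (G n) (hfin n)).symm

end Poisson

/-! ### The exponential distribution -/

/-- The Laplace transform of the exponential distribution of mean `1`. -/
lemma lintegral_expNegENN_expMeasure {c : ℝ≥0∞} (hc : c ≠ ∞) :
    ∫⁻ x, expNegENN (c * ENNReal.ofReal x) ∂(expMeasure 1) = (1 + c)⁻¹ := by
  lift c to ℝ≥0 using hc
  have hc1 : (0 : ℝ) < 1 + c := by positivity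
  -- Tilting the density of rate `1` gives a multiple of the density of rate `1 + c`.
  have hpt (x : ℝ) : exponentialPDF 1 x * expNegENN (c * ENNReal.ofReal x) =
      ENNReal.ofReal (1 + c)⁻¹ * exponentialPDF (1 + c) x := by
    rcases lt_or_ge x 0 with hx | hx
    · simp [exponentialPDF_of_neg hx]
    · rw [exponentialPDF_of_nonneg hx, exponentialPDF_of_nonneg hx, ← ENNReal.ofReal_coe_nnreal,
        ← ENNReal.ofReal_mul c.coe_nonneg, expNegENN_ofReal (by positivity),
        ← ENNReal.ofReal_mul (by positivity), ← ENNReal.ofReal_mul (by positivity),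
        inv_mul_cancel_left₀ hc1.ne', one_mul, ← Real.exp_add]
      congr 2
      ring
  have hm (r : ℝ) : Measurable (exponentialPDF r) :=
    (measurable_exponentialPDFReal r).ennreal_ofReal
  calc ∫⁻ x, expNegENN (c * ENNReal.ofReal x) ∂(expMeasure 1)
      = ∫⁻ x, exponentialPDF 1 x * expNegENN (c * ENNReal.ofReal x) :=
        lintegral_withDensity_eq_lintegral_mul _ (hm 1) (by fun_prop)
    _ = (1 + c : ℝ≥0∞)⁻¹ := by
        simp_rw [hpt]
        rw [lintegral_const_mul _ (hm _), lintegral_exponentialPDF_eq_one hc1, mul_one,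
          ENNReal.ofReal_inv_of_pos hc1, ENNReal.ofReal_add zero_le_one c.coe_nonneg]
        simp

lemma expMeasure_Iic {r : ℝ} (hr : 0 < r) {x : ℝ} (hx : 0 ≤ x) :
    expMeasure r (Iic x) = ENNReal.ofReal (1 - Real.exp (-(r * x))) := by
  have := isProbabilityMeasure_expMeasure hr
  rw [← ofReal_cdf, cdf_expMeasure_eq hr, if_pos hx]

lemma expMeasure_setOf_le_ofReal {r : ℝ} (hr : 0 < r) (a : ℝ≥0∞) :
    expMeasure r {x | a ≤ ENNReal.ofReal x} = expNegENN (ENNReal.ofReal r * a) := by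
  have := isProbabilityMeasure_expMeasure hr
  induction a with
  | top => simp [hr]
  | coe a =>
    rcases eq_or_ne a 0 with rfl | ha
    · simp
    have ha' : 0 < (a : ℝ) := by positivity
    have hset : {x : ℝ | (a : ℝ≥0∞) ≤ ENNReal.ofReal x} = (Iio (a : ℝ))ᶜ := by
      ext x
      rw [mem_ofPred_eq, ← ENNReal.ofReal_coe_nnreal, ENNReal.ofReal_le_ofReal_iff', compl_Iio,
        mem_Ici]
      exact or_iff_left ha'.not_ge
    have hatom : expMeasure r {(a : ℝ)} = 0 :=
      withDensity_absolutelyContinuous _ _ (measure_singleton (a : ℝ))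
    have hIio : expMeasure r (Iio (a : ℝ)) = expMeasure r (Iic (a : ℝ)) := by
      rw [← Iio_union_right]
      exact (measure_congr (union_ae_eq_left_of_ae_eq_empty (ae_eq_empty.2 hatom))).symm
    rw [hset, prob_compl_eq_one_sub measurableSet_Iio, hIio, expMeasure_Iic hr ha'.le,
      ← ENNReal.ofReal_one, ← ENNReal.ofReal_sub _ (sub_nonneg.2 (Real.exp_le_one_iff.2
        (by nlinarith))), sub_sub_cancel, ← ENNReal.ofReal_coe_nnreal,
      ← ENNReal.ofReal_mul hr.le, expNegENN_ofReal (by positivity)]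

/-- The probability that an exponential signal exceeds `γ` times a given noise and interference
level `D`. The convention `x / 0 = ∞` for `x > 0` makes the formula true for `D = 0`. -/
lemma expMeasure_setOf_le_div {m γ K : ℝ} (hm : 0 < m) (hγ : 0 < γ) (hK : 0 < K) (D : ℝ≥0∞) :
    expMeasure (1 / m) {x | ENNReal.ofReal γ ≤ ENNReal.ofReal (K * x) / D} =
      expNegENN (ENNReal.ofReal (γ / (K * m)) * D) := by
  have hr : 0 < 1 / m := by positivity
  have hnull : expMeasure (1 / m) (Iic 0) = 0 := by
    rw [expMeasure_Iic hr le_rfl]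
    simp
  have hae : {x | ENNReal.ofReal γ ≤ ENNReal.ofReal (K * x) / D} =ᵐ[expMeasure (1 / m)]
      {x | ENNReal.ofReal (γ / K) * D ≤ ENNReal.ofReal x} := by
    have h0 : ∀ᵐ x ∂(expMeasure (1 / m)), x ∉ Iic (0 : ℝ) := measure_eq_zero_iff_ae_notMem.1 hnull
    filter_upwards [h0] with x hx
    have hx0 : 0 < x := not_le.1 hx
    have hKx : ENNReal.ofReal (K * x) ≠ 0 := by
      simpa using mul_pos hK hx0
    refine propext ?_
    change ENNReal.ofReal γ ≤ ENNReal.ofReal (K * x) / D ↔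
      ENNReal.ofReal (γ / K) * D ≤ ENNReal.ofReal x
    rw [ENNReal.le_div_iff_mul_le (.inr hKx) (.inr ENNReal.ofReal_ne_top)]
    have hγK : ENNReal.ofReal γ = ENNReal.ofReal K * ENNReal.ofReal (γ / K) := by
      rw [← ENNReal.ofReal_mul hK.le, mul_div_cancel₀ _ hK.ne']
    rw [hγK, ENNReal.ofReal_mul hK.le, mul_assoc]
    exact ENNReal.mul_le_mul_iff_right (by simpa using hK) ENNReal.ofReal_ne_top
  rw [measure_congr hae, expMeasure_setOf_le_ofReal hr, ← mul_assoc, ← ENNReal.ofReal_mul hr.le]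
  congr 3
  field_simp

/-! ### Independence of the sources of randomness -/

section Sources

variable {Ω : Type*} {N : Network Ω}

namespace Network

lemma measurable_lines {m : MeasurableSpace Ω} (h : N.sourceAlgebra .lines ≤ m) :
    Measurable[m] fun ω i => N.line i ω :=
  measurable_iff_comap_le.2 h

lemma measurable_vehicles {m : MeasurableSpace Ω} (h : ∀ k, N.sourceAlgebra (.vehicles k) ≤ m) :
    Measurable[m] fun ω k j => N.pos k j ω :=
  measurable_pi_lambda _ fun k => measurable_iff_comap_le.2 (h k)

lemma measurable_access {m : MeasurableSpace Ω} (h : ∀ k j, N.sourceAlgebra (.access k j) ≤ m) :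
    Measurable[m] fun ω k j => N.active k j ω :=
  measurable_pi_lambda _ fun k => measurable_pi_lambda _ fun j => measurable_iff_comap_le.2 (h k j)

lemma measurable_fadings {m : MeasurableSpace Ω} (h : ∀ k j, N.sourceAlgebra (.fading k j) ≤ m) :
    Measurable[m] fun ω k j => N.fading k j ω :=
  measurable_pi_lambda _ fun k => measurable_pi_lambda _ fun j => measurable_iff_comap_le.2 (h k j)

/-- The values taken by the lines, the positions of the vehicles and the access decisions. -/
abbrev EnvSpace : Type := (ℕ → ℝ × ℝ) × (Option ℕ → ℕ → ℝ) × (Option ℕ → ℕ → Bool)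

/-- The lines, the positions of the vehicles and the access decisions, as one random variable. -/
def env (N : Network Ω) (ω : Ω) : EnvSpace :=
  (fun i => N.line i ω, fun k j => N.pos k j ω, fun k j => N.active k j ω)

lemma comap_env : MeasurableSpace.comap N.env inferInstance = N.environment := by
  refine le_antisymm (Measurable.comap_le ?_) ?_
  · refine Measurable.prodMk (measurable_lines ?_) (Measurable.prodMk (measurable_vehicles ?_)
      (measurable_access ?_))
    · exact le_sup_of_le_left le_sup_left
    · exact fun k => le_sup_of_le_left (le_sup_of_le_right
        (le_iSup (fun k => N.sourceAlgebra (.vehicles k)) k))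
    · exact fun k j => le_sup_of_le_right
        (le_iSup₂ (f := fun k j => N.sourceAlgebra (.access k j)) k j)
  · have h := comap_measurable (m := inferInstance) N.env
    refine sup_le (sup_le ?_ (iSup_le fun k => ?_)) (iSup_le fun k => iSup_le fun j => ?_)
    · exact (measurable_fst.comp h).comap_le
    · exact ((measurable_pi_apply k).comp (measurable_fst.comp (measurable_snd.comp h))).comap_le
    · exact ((measurable_pi_apply j).comp ((measurable_pi_apply k).comp
        (measurable_snd.comp (measurable_snd.comp h)))).comap_le

variable [MeasurableSpace Ω] {P : Measure Ω} {p : Params}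

/-- The sources other than the fading powers and the cross-section. -/
def envSources : Set Source :=
  {.lines} ∪ range Source.vehicles ∪ range fun x : Option ℕ × ℕ => Source.access x.1 x.2

lemma HasNetworkLaw.sourceAlgebra_le (hN : N.HasNetworkLaw P p) (s : Source) :
    N.sourceAlgebra s ≤ ‹MeasurableSpace Ω› := by
  cases s with
  | lines => exact (measurable_pi_lambda _ fun i => hN.lines.measurable i).comap_le
  | vehicles k => exact (measurable_pi_lambda _ fun j => (hN.vehicles k).measurable j).comap_le
  | access k j => exact (hN.active_measurable k j).comap_le
  | fading k j => exact (hN.fading_measurable k j).comap_le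
  | rcs => exact hN.rcs_measurable.comap_le

/-- Variables that are functions of disjoint families of sources are independent. -/
lemma HasNetworkLaw.indepFun (hN : N.HasNetworkLaw P p) {E F : Type*} {mE : MeasurableSpace E}
    {mF : MeasurableSpace F} {X : Ω → E} {Y : Ω → F} (S T : Set Source) (hST : Disjoint S T)
    (hX : Measurable[⨆ s ∈ S, N.sourceAlgebra s] X)
    (hY : Measurable[⨆ s ∈ T, N.sourceAlgebra s] Y) : IndepFun X Y P := by
  rw [IndepFun_iff_Indep]
  exact indep_of_indep_of_le_left (indep_of_indep_of_le_right
    (indep_iSup_of_disjoint hN.sourceAlgebra_le hN.indep hST) hY.comap_le) hX.comap_le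

lemma HasNetworkLaw.measurable_env (hN : N.HasNetworkLaw P p) : Measurable N.env :=
  Measurable.prodMk (measurable_lines (hN.sourceAlgebra_le _))
    (Measurable.prodMk (measurable_vehicles fun _ => hN.sourceAlgebra_le _)
      (measurable_access fun _ _ => hN.sourceAlgebra_le _))

lemma HasNetworkLaw.indepFun_env (hN : N.HasNetworkLaw P p) :
    IndepFun N.env (fun ω => (fun k j => N.fading k j ω, N.rcs ω)) P := by
  refine hN.indepFun envSources envSourcesᶜ disjoint_compl_right ?_ ?_
  · refine Measurable.prodMk (measurable_lines ?_) (Measurable.prodMk (measurable_vehicles ?_)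
      (measurable_access ?_))
    · exact le_biSup N.sourceAlgebra (by simp [envSources])
    · exact fun k => le_biSup N.sourceAlgebra (by simp [envSources])
    · exact fun k j => le_biSup N.sourceAlgebra (by simp [envSources])
  · refine Measurable.prodMk (measurable_fadings ?_) (measurable_iff_comap_le.2 ?_)
    · exact fun k j => le_biSup N.sourceAlgebra (by simp [envSources])
    · exact le_biSup N.sourceAlgebra (i := .rcs) (by simp [envSources])

lemma HasNetworkLaw.indepFun_fading_rcs (hN : N.HasNetworkLaw P p) :
    IndepFun (fun ω k j => N.fading k j ω) N.rcs P := by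
  refine hN.indepFun {.rcs}ᶜ {.rcs} disjoint_compl_left (measurable_fadings ?_)
    (measurable_iff_comap_le.2 ?_)
  · exact fun k j => le_biSup N.sourceAlgebra (by simp)
  · exact le_biSup N.sourceAlgebra (i := .rcs) (by simp)

lemma HasNetworkLaw.indepFun_access (hN : N.HasNetworkLaw P p) :
    IndepFun (fun ω => (fun i => N.line i ω, fun k j => N.pos k j ω))
      (fun ω k j => N.active k j ω) P := by
  refine hN.indepFun ({.lines} ∪ range Source.vehicles) ({.lines} ∪ range Source.vehicles)ᶜ
    disjoint_compl_right (Measurable.prodMk (measurable_lines ?_) (measurable_vehicles ?_))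
    (measurable_access ?_)
  · exact le_biSup N.sourceAlgebra (by simp)
  · exact fun k => le_biSup N.sourceAlgebra (by simp)
  · exact fun k j => le_biSup N.sourceAlgebra (by simp)

lemma HasNetworkLaw.indepFun_vehicles (hN : N.HasNetworkLaw P p) :
    IndepFun (fun ω i => N.line i ω) (fun ω k j => N.pos k j ω) P := by
  refine hN.indepFun {.lines} {.lines}ᶜ disjoint_compl_right (measurable_lines ?_)
    (measurable_vehicles ?_)
  · exact le_biSup N.sourceAlgebra (by simp)
  · exact fun k => le_biSup N.sourceAlgebra (by simp)

lemma HasNetworkLaw.iIndepFun_fading (hN : N.HasNetworkLaw P p) :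
    iIndepFun (fun (x : Option ℕ × ℕ) => N.fading x.1 x.2) P :=
  (iIndepFun_iff_iIndep _ _ _).2 (hN.indep.precomp (g := fun x : Option ℕ × ℕ =>
    Source.fading x.1 x.2) fun x y h => by simpa [Prod.ext_iff] using h)

lemma HasNetworkLaw.iIndepFun_access (hN : N.HasNetworkLaw P p) :
    iIndepFun (fun (x : Option ℕ × ℕ) => N.active x.1 x.2) P :=
  (iIndepFun_iff_iIndep _ _ _).2 (hN.indep.precomp (g := fun x : Option ℕ × ℕ =>
    Source.access x.1 x.2) fun x y h => by simpa [Prod.ext_iff] using h)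

lemma HasNetworkLaw.iIndepFun_vehicles (hN : N.HasNetworkLaw P p) :
    iIndepFun (fun k ω j => N.pos k j ω) P :=
  (iIndepFun_iff_iIndep _ _ _).2 (hN.indep.precomp (g := Source.vehicles)
    fun x y h => by simpa using h)

end Network

end Sources

/-! ### The interference as a function of the sources -/

lemma lintegral_indicator_one_comp {Ω E : Type*} [MeasurableSpace Ω] [MeasurableSpace E]
    {P : Measure Ω} {X : Ω → E} (hX : Measurable X) {s : Set E} (hs : MeasurableSet s) :
    ∫⁻ ω, s.indicator (fun _ => (1 : ℝ≥0∞)) (X ω) ∂P = P (X ⁻¹' s) := by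
  rw [← lintegral_map (measurable_const.indicator hs) hX, ← Measure.map_apply hX hs]
  exact lintegral_indicator_one hs

lemma continuous_linePoint : Continuous fun x : (ℝ × ℝ) × ℝ => linePoint x.1 x.2 := by
  refine (PiLp.continuous_toLp 2 _).comp (continuous_pi fun i => ?_)
  fin_cases i
  · simp; fun_prop
  · simp; fun_prop

lemma continuous_lineDir : Continuous lineDir := by
  refine (PiLp.continuous_toLp 2 _).comp (continuous_pi fun i => ?_)
  fin_cases i
  · simp; fun_prop
  · simp; fun_prop

lemma measurableSet_interferes (β : ℝ) :
    MeasurableSet {x : (ℝ × ℝ) × ℝ | Interferes β x.1 (linePoint x.1 x.2)} := by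
  have h1 := continuous_linePoint
  have h2 := continuous_lineDir
  unfold Interferes sector
  refine MeasurableSet.inter (MeasurableSet.union ?_ ?_) ?_ <;>
  exact measurableSet_lt (by fun_prop) (by fun_prop)

open Classical in
/-- The received interference power, for unit fading, of a radar at position `t` on the street `q`;
it is `0` if the radar does not interfere. -/
def pathGain (p : Params) (q : ℝ × ℝ) (t : ℝ) : ℝ≥0∞ :=
  if Interferes p.beamwidth q (linePoint q t) then
    ENNReal.ofReal (p.crossGain * p.gain * p.power) * ENNReal.ofReal ‖linePoint q t‖ ^ (-p.α)
  else 0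

lemma measurable_pathGain (p : Params) :
    Measurable fun x : (ℝ × ℝ) × ℝ => pathGain p x.1 x.2 := by
  have h := continuous_linePoint
  unfold pathGain
  exact Measurable.ite (measurableSet_interferes _) (by fun_prop) measurable_const

/-- The path gain is finite although `0 ^ (-α) = ∞`, because a radar at the origin does not interfere. -/
lemma pathGain_ne_top (p : Params) (q : ℝ × ℝ) (t : ℝ) : pathGain p q t ≠ ∞ := by
  unfold pathGain
  split_ifs with h
  · refine ENNReal.mul_ne_top ENNReal.ofReal_ne_top ?_
    have hne : linePoint q t ≠ 0 := by
      intro h0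
      have := h.2
      simp [sector, h0] at this
    exact ENNReal.rpow_ne_top_of_ne_zero (by simpa using hne) ENNReal.ofReal_ne_top
  · simp

/-- The parameters of the street `k`, given those of the lines of the line process. -/
def streetOf (L : ℕ → ℝ × ℝ) : Option ℕ → ℝ × ℝ
  | none => (0, 0)
  | some i => L i

@[fun_prop]
lemma measurable_streetOf (k : Option ℕ) : Measurable fun L => streetOf L k := by
  cases k with
  | none => exact measurable_const
  | some i => exact measurable_pi_apply i

section Network

variable {Ω : Type*} [MeasurableSpace Ω] {P : Measure Ω} {p : Params} {N : Network Ω}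

namespace Network

omit [MeasurableSpace Ω] in
lemma street_eq (k : Option ℕ) (ω : Ω) : N.street k ω = streetOf (N.env ω).1 k := by
  cases k <;> rfl

/-- The total interference for given streets, vehicles, access decisions and fading powers. -/
def interferenceOf (p : Params) (x : EnvSpace) (h : Option ℕ → ℕ → ℝ) : ℝ≥0∞ :=
  ∑' (k : Option ℕ) (j : ℕ), if x.2.2 k j = true then
    pathGain p (streetOf x.1 k) (x.2.1 k j) * ENNReal.ofReal (h k j) else 0

omit [MeasurableSpace Ω] in
open Classical in
lemma interference_eq (hp : p.Admissible) (ω : Ω) :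
    N.interference p ω = interferenceOf p (N.env ω) fun k j => N.fading k j ω := by
  have h0 : 0 ≤ p.crossGain * p.gain * p.power :=
    mul_nonneg (mul_nonneg hp.crossGain_pos.le hp.gain_pos.le) hp.power_pos.le
  unfold interference interferenceOf
  refine tsum_congr fun k => tsum_congr fun j => ?_
  have hgain : pathGain p (streetOf (N.env ω).1 k) (N.pos k j ω) =
      if Interferes p.beamwidth (N.street k ω) (N.location k j ω) then
        ENNReal.ofReal (p.crossGain * p.gain * p.power) *
          ENNReal.ofReal ‖N.location k j ω‖ ^ (-p.α) else 0 := by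
    rw [← street_eq]
    rfl
  change _ = if N.active k j ω = true then
    pathGain p (streetOf (N.env ω).1 k) (N.pos k j ω) * ENNReal.ofReal (N.fading k j ω) else 0
  rw [hgain, ENNReal.ofReal_mul h0]
  by_cases ha : N.active k j ω = true <;>
  by_cases hi : Interferes p.beamwidth (N.street k ω) (N.location k j ω) <;>
  simp [ha, hi, mul_right_comm]

lemma measurable_envStreet (k : Option ℕ) : Measurable fun x : EnvSpace => streetOf x.1 k :=
  (measurable_streetOf k).comp measurable_fst

lemma measurable_eval₂ {α : Type*} [MeasurableSpace α] (k : Option ℕ) (j : ℕ) :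
    Measurable fun h : Option ℕ → ℕ → α => h k j :=
  (measurable_pi_apply j).comp (measurable_pi_apply k)

lemma measurable_envPos (k : Option ℕ) (j : ℕ) : Measurable fun x : EnvSpace => x.2.1 k j :=
  (measurable_eval₂ k j).comp (measurable_fst.comp measurable_snd)

lemma measurableSet_envActive (k : Option ℕ) (j : ℕ) :
    MeasurableSet {x : EnvSpace | x.2.2 k j = true} :=
  ((measurable_eval₂ k j).comp (measurable_snd.comp measurable_snd) :
    Measurable fun x : EnvSpace => x.2.2 k j) (measurableSet_singleton true)

lemma measurable_interferenceOf (p : Params) :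
    Measurable fun z : EnvSpace × (Option ℕ → ℕ → ℝ) => interferenceOf p z.1 z.2 := by
  unfold interferenceOf
  refine Measurable.tsum fun k => Measurable.tsum fun j => Measurable.ite ?_ ?_ measurable_const
  · exact (measurableSet_envActive k j).preimage measurable_fst
  · exact ((measurable_pathGain p).comp (((measurable_envStreet k).comp measurable_fst).prodMk
      ((measurable_envPos k j).comp measurable_fst))).mul
      ((measurable_eval₂ k j).comp measurable_snd).ennreal_ofReal

end Network

/-! ### The conditional detection probability -/

/-- The amplitude of the received signal: the SINR is this number times the cross-section, divided
by noise plus interference. -/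
def Params.signal (p : Params) : ℝ := p.gain * p.power * p.R ^ (-2 * p.α)

/-- The rate at which noise and interference enter the conditional detection probability. -/
def Params.rate (p : Params) : ℝ := p.threshold / (p.signal * p.meanRCS)

lemma Params.Admissible.signal_pos (hp : p.Admissible) : 0 < p.signal :=
  mul_pos (mul_pos hp.gain_pos hp.power_pos) (Real.rpow_pos_of_pos hp.R_pos _)

lemma Params.Admissible.rate_pos (hp : p.Admissible) : 0 < p.rate :=
  div_pos hp.threshold_pos (mul_pos hp.signal_pos hp.meanRCS_pos)

/-- `-log` of the Laplace transform of the contribution of an active radar to the interference. -/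
def radarExponent (p : Params) (q : ℝ × ℝ) (t : ℝ) : ℝ≥0∞ :=
  negLog (1 + ENNReal.ofReal p.rate * pathGain p q t)⁻¹

lemma measurable_radarExponent {E : Type*} [MeasurableSpace E] (p : Params) {q : E → ℝ × ℝ}
    {t : E → ℝ} (hq : Measurable q) (ht : Measurable t) :
    Measurable fun x => radarExponent p (q x) (t x) := by
  have h := (measurable_pathGain p).comp (hq.prodMk ht)
  simp only [Function.comp_def] at h
  unfold radarExponent
  fun_prop

namespace Network

/-- `-log` of the conditional detection probability, for given streets, vehicles and access
decisions. -/
def detectionExponent (p : Params) (x : EnvSpace) : ℝ≥0∞ :=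
  ENNReal.ofReal (p.rate * p.noise) + ∑' (k : Option ℕ) (j : ℕ),
    if x.2.2 k j = true then radarExponent p (streetOf x.1 k) (x.2.1 k j) else 0

lemma measurable_detectionExponent (p : Params) : Measurable (detectionExponent p) := by
  have h (k j) : Measurable fun x : EnvSpace => radarExponent p (streetOf x.1 k) (x.2.1 k j) :=
    measurable_radarExponent p (measurable_envStreet k) (measurable_envPos k j)
  have h2 (k j) : Measurable fun x : EnvSpace =>
      if x.2.2 k j = true then radarExponent p (streetOf x.1 k) (x.2.1 k j) else 0 :=
    (h k j).ite (measurableSet_envActive k j) measurable_const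
  exact (Measurable.tsum fun k => Measurable.tsum fun j => h2 k j).const_add _

/-- The event of detection, for given streets, vehicles and access decisions. -/
def detectionSet (p : Params) (x : EnvSpace) : Set ((Option ℕ → ℕ → ℝ) × ℝ) :=
  {y | ENNReal.ofReal p.threshold ≤ ENNReal.ofReal (p.signal * y.2) /
    (ENNReal.ofReal p.noise + interferenceOf p x y.1)}

lemma measurableSet_detectionSet (p : Params) :
    MeasurableSet {z : EnvSpace × ((Option ℕ → ℕ → ℝ) × ℝ) | z.2 ∈ detectionSet p z.1} := by
  have h : Measurable fun z : EnvSpace × ((Option ℕ → ℕ → ℝ) × ℝ) => interferenceOf p z.1 z.2.1 :=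
    (measurable_interferenceOf p).comp (measurable_fst.prodMk (measurable_fst.comp measurable_snd))
  have h2 : Measurable fun z : EnvSpace × ((Option ℕ → ℕ → ℝ) × ℝ) =>
      ENNReal.ofReal (p.signal * z.2.2) :=
    ((measurable_snd.comp measurable_snd).const_mul _).ennreal_ofReal
  exact measurableSet_le measurable_const (h2.div (h.const_add _))

omit [MeasurableSpace Ω] in
lemma threshold_le_sinr_iff (hp : p.Admissible) (ω : Ω) :
    ENNReal.ofReal p.threshold ≤ N.sinr p ω ↔
      (fun k j => N.fading k j ω, N.rcs ω) ∈ detectionSet p (N.env ω) := by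
  rw [sinr, interference_eq hp, detectionSet, mem_ofPred_eq, Params.signal]
  ring_nf

/-- Averaging over the fading powers. -/
lemma HasNetworkLaw.lintegral_expNegENN_interferenceOf [IsProbabilityMeasure P]
    (hN : N.HasNetworkLaw P p) (x : EnvSpace) :
    ∫⁻ ω, expNegENN (ENNReal.ofReal p.rate * interferenceOf p x fun k j => N.fading k j ω) ∂P =
      expNegENN (∑' (k : Option ℕ) (j : ℕ),
        if x.2.2 k j = true then radarExponent p (streetOf x.1 k) (x.2.1 k j) else 0) := by
  let c : Option ℕ × ℕ → ℝ≥0∞ := fun y => if x.2.2 y.1 y.2 = true then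
    ENNReal.ofReal p.rate * pathGain p (streetOf x.1 y.1) (x.2.1 y.1 y.2) else 0
  have hc (y) : c y ≠ ∞ := by
    dsimp only [c]
    split_ifs
    · exact ENNReal.mul_ne_top ENNReal.ofReal_ne_top (pathGain_ne_top _ _ _)
    · simp
  have hfm := hN.fading_measurable
  have hsum (ω : Ω) : ENNReal.ofReal p.rate * interferenceOf p x (fun k j => N.fading k j ω) =
      ∑' y, c y * ENNReal.ofReal (N.fading y.1 y.2 ω) := by
    rw [interferenceOf, ENNReal.tsum_prod', ← ENNReal.tsum_mul_left]
    refine tsum_congr fun k => ?_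
    rw [← ENNReal.tsum_mul_left]
    refine tsum_congr fun j => ?_
    dsimp only [c]
    split_ifs
    · rw [mul_assoc]
    · simp
  have hone (y) : negLog (∫⁻ ω, expNegENN (c y * ENNReal.ofReal (N.fading y.1 y.2 ω)) ∂P) =
      if x.2.2 y.1 y.2 = true then radarExponent p (streetOf x.1 y.1) (x.2.1 y.1 y.2) else 0 := by
    rw [← lintegral_map (f := fun h => expNegENN (c y * ENNReal.ofReal h)) (by fun_prop)
      (hfm y.1 y.2), hN.fading_law, lintegral_expNegENN_expMeasure (hc y)]
    dsimp only [c, radarExponent]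
    split_ifs
    · rfl
    · simp [negLog]
  simp_rw [hsum]
  rw [lintegral_expNegENN_tsum_of_iIndepFun
    (ξ := fun y ω => c y * ENNReal.ofReal (N.fading y.1 y.2 ω))
    (fun y => by have := hfm y.1 y.2; fun_prop)
    (hN.iIndepFun_fading.comp (fun y h => c y * ENNReal.ofReal h) fun y => by fun_prop)]
  simp_rw [hone]
  rw [ENNReal.tsum_prod']

/-- The probability of detection, for given streets, vehicles and access decisions. -/
lemma HasNetworkLaw.measure_detectionSet [IsProbabilityMeasure P] (hp : p.Admissible)
    (hN : N.HasNetworkLaw P p) (x : EnvSpace) :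
    P {ω | (fun k j => N.fading k j ω, N.rcs ω) ∈ detectionSet p x} =
      expNegENN (detectionExponent p x) := by
  have hF : Measurable fun ω k j => N.fading k j ω := measurable_fadings fun _ _ => hN.sourceAlgebra_le _
  have hms : MeasurableSet (detectionSet p x) :=
    (measurableSet_detectionSet p).preimage measurable_prodMk_left
  have hrcs (ω : Ω) : ∫⁻ ω', (detectionSet p x).indicator (fun _ => 1)
      (fun k j => N.fading k j ω, N.rcs ω') ∂P = expNegENN (ENNReal.ofReal p.rate *
        (ENNReal.ofReal p.noise + interferenceOf p x fun k j => N.fading k j ω)) := by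
    have hs : MeasurableSet (Prod.mk (fun k j => N.fading k j ω) ⁻¹' detectionSet p x) :=
      measurable_prodMk_left hms
    have hpair : Measurable fun ω' => ((fun k j => N.fading k j ω : Option ℕ → ℕ → ℝ), N.rcs ω') :=
      measurable_prodMk_left.comp hN.rcs_measurable
    rw [lintegral_indicator_one_comp hpair hms]
    have hpre : (fun ω' => ((fun k j => N.fading k j ω : Option ℕ → ℕ → ℝ), N.rcs ω')) ⁻¹'
        detectionSet p x = N.rcs ⁻¹' (Prod.mk (fun k j => N.fading k j ω) ⁻¹' detectionSet p x) :=
      rfl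
    have hset : Prod.mk (fun k j => N.fading k j ω) ⁻¹' detectionSet p x =
        {s | ENNReal.ofReal p.threshold ≤ ENNReal.ofReal (p.signal * s) /
          (ENNReal.ofReal p.noise + interferenceOf p x fun k j => N.fading k j ω)} := rfl
    rw [hpre, ← Measure.map_apply hN.rcs_measurable hs, hN.rcs_law, hset,
      expMeasure_setOf_le_div hp.meanRCS_pos hp.threshold_pos hp.signal_pos, Params.rate]
  have h1 := lintegral_indicator_one_comp (P := P) (hF.prodMk hN.rcs_measurable) hms
  have h2 := lintegral_of_indepFun
    (f := fun h s => (detectionSet p x).indicator (fun _ => (1 : ℝ≥0∞)) (h, s))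
    hF hN.rcs_measurable hN.indepFun_fading_rcs (measurable_const.indicator hms)
  have hmi := ((measurable_interferenceOf p).comp (measurable_prodMk_left (x := x))).comp hF
  simp only [Function.comp_def] at hmi
  simp_rw [hrcs, mul_add, expNegENN_add] at h2
  rw [lintegral_const_mul _ (by fun_prop), hN.lintegral_expNegENN_interferenceOf,
    ← ENNReal.ofReal_mul hp.rate_pos.le, ← expNegENN_add] at h2
  exact h1.symm.trans h2

/-- The conditional detection probability is `exp (-detectionExponent)`. -/
lemma HasNetworkLaw.detectionProb_ae_eq [IsProbabilityMeasure P] (hp : p.Admissible)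
    (hN : N.HasNetworkLaw P p) :
    N.detectionProb P p =ᵐ[P] fun ω => expNeg (detectionExponent p (N.env ω)) := by
  have hX := hN.measurable_env
  have hY : Measurable fun ω => (fun k j => N.fading k j ω, N.rcs ω) :=
    (measurable_fadings fun _ _ => hN.sourceAlgebra_le _).prodMk hN.rcs_measurable
  have hset : {ω | ENNReal.ofReal p.threshold ≤ N.sinr p ω} =
      {ω | (fun k j => N.fading k j ω, N.rcs ω) ∈ detectionSet p (N.env ω)} :=
    ext fun ω => threshold_le_sinr_iff hp ω
  have hD : MeasurableSet {ω | ENNReal.ofReal p.threshold ≤ N.sinr p ω} := by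
    rw [hset]
    exact (hX.prodMk hY) (measurableSet_detectionSet p)
  have hem : Measurable fun x => expNegENN (detectionExponent p x) :=
    measurable_expNegENN.comp (measurable_detectionExponent p)
  have hle : N.environment ≤ ‹MeasurableSpace Ω› := by
    rw [← comap_env]
    exact hX.comap_le
  simp_rw [← toReal_expNegENN]
  have hint : Integrable (fun ω => (expNegENN (detectionExponent p (N.env ω))).toReal) P :=
    integrable_toReal_of_lintegral_ne_top (hem.comp hX).aemeasurable
      (ne_top_of_le_ne_top ENNReal.one_ne_top (lintegral_expNegENN_le_one _))
  refine (ae_eq_condExp_of_forall_setIntegral_eq hle ((integrable_const 1).indicator hD)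
    (fun _ _ _ => hint.integrableOn) (fun s hs _ => ?_) ?_).symm
  · have hs' := hle s hs
    rw [← comap_env] at hs
    obtain ⟨B, hB, rfl⟩ := hs
    have hf : Measurable (Function.uncurry fun (x : EnvSpace) (y : (Option ℕ → ℕ → ℝ) × ℝ) =>
        B.indicator (fun _ => (1 : ℝ≥0∞)) x * (detectionSet p x).indicator (fun _ => 1) y) :=
      ((measurable_const.indicator hB).comp measurable_fst).mul
        (measurable_const.indicator (measurableSet_detectionSet p))
    have hinner (ω : Ω) : ∫⁻ ω', B.indicator (fun _ => (1 : ℝ≥0∞)) (N.env ω) *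
        (detectionSet p (N.env ω)).indicator (fun _ => 1)
          (fun k j => N.fading k j ω', N.rcs ω') ∂P =
        (N.env ⁻¹' B).indicator (fun ω => expNegENN (detectionExponent p (N.env ω))) ω := by
      have hms : MeasurableSet (detectionSet p (N.env ω)) :=
        (measurableSet_detectionSet p).preimage measurable_prodMk_left
      have hmi : Measurable fun ω' => (detectionSet p (N.env ω)).indicator (fun _ => (1 : ℝ≥0∞))
        (fun k j => N.fading k j ω', N.rcs ω') := (measurable_const.indicator hms).comp hY
      rw [lintegral_const_mul _ hmi, show ∫⁻ ω', (detectionSet p (N.env ω)).indicator (fun _ => (1 : ℝ≥0∞))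
        (fun k j => N.fading k j ω', N.rcs ω') ∂P = expNegENN (detectionExponent p (N.env ω)) from
        (lintegral_indicator_one_comp hY hms).trans (hN.measure_detectionSet hp _)]
      by_cases hω : N.env ω ∈ B <;> simp [hω]
    -- On an event of the environment only the fading powers and the cross-section are averaged.
    have hkey := lintegral_of_indepFun hX hY hN.indepFun_env hf
    simp_rw [hinner] at hkey
    rw [lintegral_indicator hs'] at hkey
    have hemX : Measurable fun ω => expNegENN (detectionExponent p (N.env ω)) := hem.comp hX
    rw [integral_toReal hemX.aemeasurable (.of_forall fun _ => (expNegENN_ne_top _).lt_top),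
      setIntegral_indicator hD, setIntegral_const, smul_eq_mul, mul_one, measureReal_def,
      ← hkey, ← lintegral_indicator_one (hs'.inter hD)]
    congr 1
    refine lintegral_congr fun ω => ?_
    rw [hset]
    by_cases h1 : N.env ω ∈ B <;>
    by_cases h2 : (fun k j => N.fading k j ω, N.rcs ω) ∈ detectionSet p (N.env ω) <;>
    simp [indicator, h1, h2]
  · rw [← comap_env]
    exact (hem.ennreal_toReal.comp (comap_measurable N.env)).aestronglyMeasurable

end Network

end Network

/-! ### The Laplace functional of the thinned Poisson line Cox process -/

/-- Thinning: the exponential factor of a point that is kept with probability `d`. -/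
lemma thinning_add {d e : ℝ≥0∞} (hd : d ≤ 1) (he : e ≤ 1) :
    d * e + (1 - d) + d * (1 - e) = 1 := by
  rw [add_right_comm, ← mul_add, add_tsub_cancel_of_le he, mul_one, add_tsub_cancel_of_le hd]

lemma one_sub_thinning {d e : ℝ≥0∞} (hd : d ≤ 1) (he : e ≤ 1) :
    1 - (d * e + (1 - d)) = d * (1 - e) := by
  have h := thinning_add hd he
  refine (ENNReal.eq_sub_of_add_eq ?_ ((add_comm _ _).trans h)).symm
  exact ne_top_of_le_ne_top ENNReal.one_ne_top (le_self_add.trans_eq h)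

lemma thinning_le_one {d e : ℝ≥0∞} (hd : d ≤ 1) (he : e ≤ 1) : d * e + (1 - d) ≤ 1 :=
  le_self_add.trans_eq (thinning_add hd he)

instance sigmaFinite_ofReal_smul {E : Type*} [MeasurableSpace E] (μ : Measure E) [SigmaFinite μ]
    (c : ℝ) : SigmaFinite (ENNReal.ofReal c • μ) :=
  inferInstanceAs (SigmaFinite (c.toNNReal • μ))

lemma tsum_option_ennreal (f : Option ℕ → ℝ≥0∞) : ∑' k, f k = f none + ∑' i, f (some i) := by
  rw [← (Equiv.optionEquivSumPUnit.{0} ℕ).symm.tsum_eq f,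
    ENNReal.summable.tsum_sum ENNReal.summable, add_comm]
  simp

/-- The intensity integral of the thinned vehicles on the street `q` for the weight `φ`. -/
def streetExponent (p : Params) (φ : ℝ × ℝ → ℝ → ℝ≥0∞) (q : ℝ × ℝ) : ℝ≥0∞ :=
  ENNReal.ofReal (p.access * p.vehicleIntensity) * ∫⁻ t, (1 - expNegENN (φ q t))

lemma measurable_streetExponent (p : Params) {φ : ℝ × ℝ → ℝ → ℝ≥0∞}
    (hφ : Measurable fun x : (ℝ × ℝ) × ℝ => φ x.1 x.2) : Measurable (streetExponent p φ) := by
  have h : Measurable fun x : (ℝ × ℝ) × ℝ => 1 - expNegENN (φ x.1 x.2) := by fun_prop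
  exact h.lintegral_prod_right'.const_mul _

section Network

variable {Ω : Type*} [MeasurableSpace Ω] {P : Measure Ω} {p : Params} {N : Network Ω}

namespace Network

/-- Averaging over the access decisions. -/
lemma HasNetworkLaw.lintegral_expNegENN_access [IsProbabilityMeasure P]
    (hN : N.HasNetworkLaw P p) (c : Option ℕ → ℕ → ℝ≥0∞) :
    ∫⁻ ω, expNegENN (∑' (k : Option ℕ) (j : ℕ), if N.active k j ω = true then c k j else 0) ∂P =
      expNegENN (∑' (k : Option ℕ) (j : ℕ), negLog (ENNReal.ofReal p.access * expNegENN (c k j) +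
        (1 - ENNReal.ofReal p.access))) := by
  have hm := hN.active_measurable
  have hA (k j) : MeasurableSet {ω | N.active k j ω = true} := hm k j (measurableSet_singleton true)
  have hone (k j) : ∫⁻ ω, expNegENN (if N.active k j ω = true then c k j else 0) ∂P =
      ENNReal.ofReal p.access * expNegENN (c k j) + (1 - ENNReal.ofReal p.access) := by
    rw [← lintegral_add_compl _ (hA k j),
      setLIntegral_congr_fun (g := fun _ => expNegENN (c k j)) (hA k j) fun ω hω => by
        rw [if_pos (show N.active k j ω = true from hω)],
      setLIntegral_congr_fun (g := fun _ => 1) (hA k j).compl fun ω hω => by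
        rw [if_neg (show ¬ N.active k j ω = true from hω), expNegENN_zero],
      setLIntegral_const, setLIntegral_const, one_mul, prob_compl_eq_one_sub (hA k j),
      hN.active_law, mul_comm]
  have h := lintegral_expNegENN_tsum_of_iIndepFun
    (ξ := fun (y : Option ℕ × ℕ) ω => if N.active y.1 y.2 ω = true then c y.1 y.2 else 0)
    (fun y => measurable_const.ite (hA y.1 y.2) measurable_const)
    (hN.iIndepFun_access.comp (fun y b => if b = true then c y.1 y.2 else 0)
      fun y => measurable_of_countable _)
  simp_rw [hone, ENNReal.tsum_prod'] at h
  exact h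

/-- Averaging over the vehicles of the streets of a given line pattern. -/
lemma HasNetworkLaw.lintegral_expNegENN_vehicles [IsProbabilityMeasure P]
    (hN : N.HasNetworkLaw P p) {φ : ℝ × ℝ → ℝ → ℝ≥0∞}
    (hφ : Measurable fun x : (ℝ × ℝ) × ℝ => φ x.1 x.2) (L : ℕ → ℝ × ℝ) :
    ∫⁻ ω, expNegENN (∑' (k : Option ℕ) (j : ℕ), φ (streetOf L k) (N.pos k j ω)) ∂P =
      expNegENN (∑' k, ENNReal.ofReal p.vehicleIntensity *
        ∫⁻ t, (1 - expNegENN (φ (streetOf L k) t))) := by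
  have hφ' (q) : Measurable (φ q) := hφ.comp measurable_prodMk_left
  have hpos (k j) := (hN.vehicles k).measurable j
  have hone (k) : ∫⁻ ω, expNegENN (∑' j, φ (streetOf L k) (N.pos k j ω)) ∂P =
      expNegENN (ENNReal.ofReal p.vehicleIntensity *
        ∫⁻ t, (1 - expNegENN (φ (streetOf L k) t))) := by
    rw [(hN.vehicles k).lintegral_expNegENN_tsum (hφ' _), lintegral_smul_measure, smul_eq_mul]
  have hF (k) : Measurable fun T : ℕ → ℝ => ∑' j, φ (streetOf L k) (T j) :=
    Measurable.tsum fun j => (hφ' _).comp (measurable_pi_apply j)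
  have h := lintegral_expNegENN_tsum_of_iIndepFun
    (ξ := fun k ω => ∑' j, φ (streetOf L k) (N.pos k j ω))
    (fun k => Measurable.tsum fun j => (hφ' _).comp (hpos k j))
    (hN.iIndepFun_vehicles.comp (fun k T => ∑' j, φ (streetOf L k) (T j)) hF)
  simp_rw [hone, negLog_expNegENN] at h
  exact h

/-- The conditional Laplace functional of the active vehicles given the lines and the vehicles. -/
lemma HasNetworkLaw.lintegral_expNegENN_active_eq_vehicles [IsProbabilityMeasure P]
    (hN : N.HasNetworkLaw P p) {φ : ℝ × ℝ → ℝ → ℝ≥0∞}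
    (hφ : Measurable fun x : (ℝ × ℝ) × ℝ => φ x.1 x.2) :
    ∫⁻ ω, expNegENN (∑' (k : Option ℕ) (j : ℕ), if N.active k j ω = true then
        φ (streetOf (fun i => N.line i ω) k) (N.pos k j ω) else 0) ∂P =
      ∫⁻ ω, expNegENN (∑' (k : Option ℕ) (j : ℕ), negLog (ENNReal.ofReal p.access *
        expNegENN (φ (streetOf (fun i => N.line i ω) k) (N.pos k j ω)) +
          (1 - ENNReal.ofReal p.access))) ∂P := by
  have hL : Measurable fun ω i => N.line i ω := measurable_lines (hN.sourceAlgebra_le _)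
  have hT : Measurable fun ω k j => N.pos k j ω := measurable_vehicles fun _ => hN.sourceAlgebra_le _
  have hA : Measurable fun ω k j => N.active k j ω :=
    measurable_access fun _ _ => hN.sourceAlgebra_le _
  have hf (k j) : Measurable fun z : ((ℕ → ℝ × ℝ) × (Option ℕ → ℕ → ℝ)) × (Option ℕ → ℕ → Bool) =>
      if z.2 k j = true then φ (streetOf z.1.1 k) (z.1.2 k j) else 0 := by
    have h1 : Measurable fun z : ((ℕ → ℝ × ℝ) × (Option ℕ → ℕ → ℝ)) × (Option ℕ → ℕ → Bool) =>
        z.2 k j := (measurable_eval₂ k j).comp measurable_snd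
    have h2 := hφ.comp (((measurable_streetOf k).comp measurable_fst).prodMk
      ((measurable_eval₂ (α := ℝ) k j).comp measurable_snd))
    exact (h2.comp measurable_fst).ite (h1 (measurableSet_singleton true)) measurable_const
  have h1 := lintegral_of_indepFun (hL.prodMk hT) hA hN.indepFun_access
    (f := fun x a => expNegENN (∑' (k : Option ℕ) (j : ℕ),
      if a k j = true then φ (streetOf x.1 k) (x.2 k j) else 0))
    (measurable_expNegENN.comp (Measurable.tsum fun k => Measurable.tsum fun j => hf k j))
  simp_rw [hN.lintegral_expNegENN_access] at h1
  exact h1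

/-- The conditional Laplace functional of the vehicles given the lines. -/
lemma HasNetworkLaw.lintegral_expNegENN_vehicles_eq_lines [IsProbabilityMeasure P]
    (hN : N.HasNetworkLaw P p) {φ : ℝ × ℝ → ℝ → ℝ≥0∞}
    (hφ : Measurable fun x : (ℝ × ℝ) × ℝ => φ x.1 x.2) :
    ∫⁻ ω, expNegENN (∑' (k : Option ℕ) (j : ℕ),
        φ (streetOf (fun i => N.line i ω) k) (N.pos k j ω)) ∂P =
      ∫⁻ ω, expNegENN (∑' k, ENNReal.ofReal p.vehicleIntensity *
        ∫⁻ t, (1 - expNegENN (φ (streetOf (fun i => N.line i ω) k) t))) ∂P := by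
  have hL : Measurable fun ω i => N.line i ω := measurable_lines (hN.sourceAlgebra_le _)
  have hT : Measurable fun ω k j => N.pos k j ω := measurable_vehicles fun _ => hN.sourceAlgebra_le _
  have hg (k j) := hφ.comp (((measurable_streetOf k).comp measurable_fst).prodMk
      ((measurable_eval₂ (α := ℝ) k j).comp measurable_snd))
  have h2 := lintegral_of_indepFun hL hT hN.indepFun_vehicles
    (f := fun L T => expNegENN (∑' (k : Option ℕ) (j : ℕ), φ (streetOf L k) (T k j)))
    (measurable_expNegENN.comp (Measurable.tsum fun k => Measurable.tsum fun j => hg k j))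
  simp_rw [hN.lintegral_expNegENN_vehicles hφ] at h2
  exact h2

/-- The Laplace functional of the active vehicles on all streets: a factor for the street of the ego
radar, and the Laplace functional of the Poisson line process at the exponent of a street. -/
theorem HasNetworkLaw.lintegral_expNegENN_active [IsProbabilityMeasure P] (hp : p.Admissible)
    (hN : N.HasNetworkLaw P p) {φ : ℝ × ℝ → ℝ → ℝ≥0∞}
    (hφ : Measurable fun x : (ℝ × ℝ) × ℝ => φ x.1 x.2) :
    ∫⁻ ω, expNegENN (∑' (k : Option ℕ) (j : ℕ), if N.active k j ω = true then
        φ (streetOf (fun i => N.line i ω) k) (N.pos k j ω) else 0) ∂P =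
      expNegENN (streetExponent p φ (0, 0)) *
        expNegENN (ENNReal.ofReal p.lineIntensity * ∫⁻ q in Ico 0 (2 * Real.pi) ×ˢ Ioi 0,
          (1 - expNegENN (streetExponent p φ q))) := by
  have hd : ENNReal.ofReal p.access ≤ 1 := ENNReal.ofReal_le_one.2 hp.access_mem.2
  have hthin : Measurable fun x : (ℝ × ℝ) × ℝ => negLog (ENNReal.ofReal p.access *
      expNegENN (φ x.1 x.2) + (1 - ENNReal.ofReal p.access)) := by fun_prop
  have hexp (q) : ENNReal.ofReal p.vehicleIntensity * ∫⁻ t, (1 - expNegENN (negLog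
      (ENNReal.ofReal p.access * expNegENN (φ q t) + (1 - ENNReal.ofReal p.access)))) =
      streetExponent p φ q := by
    have hq : Measurable (φ q) := hφ.comp measurable_prodMk_left
    simp_rw [expNegENN_negLog (thinning_le_one hd (expNegENN_le_one _)),
        one_sub_thinning hd (expNegENN_le_one _)]
    rw [lintegral_const_mul _ (by fun_prop), streetExponent, ENNReal.ofReal_mul hp.access_mem.1,
      ← mul_assoc, mul_comm (ENNReal.ofReal p.vehicleIntensity)]
  have h2 := hN.lintegral_expNegENN_vehicles_eq_lines (φ := fun q t => negLog
    (ENNReal.ofReal p.access * expNegENN (φ q t) + (1 - ENNReal.ofReal p.access))) hthin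
  simp only [hexp] at h2
  simp_rw [tsum_option_ennreal (fun k => streetExponent p φ _), expNegENN_add] at h2
  have hS := measurable_streetExponent p hφ
  have h3 := hN.lines.lintegral_expNegENN_tsum hS
  rw [lintegral_smul_measure, smul_eq_mul] at h3
  rw [hN.lintegral_expNegENN_active_eq_vehicles hφ, h2]
  simp only [streetOf]
  rw [lintegral_const_mul' _ _ (expNegENN_ne_top _), h3]

/-- The moments in terms of the exponents of the streets. -/
theorem HasNetworkLaw.moment_eq [IsProbabilityMeasure P] (hp : p.Admissible)
    (hN : N.HasNetworkLaw P p) (l : ℕ) :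
    N.moment P p l = Real.exp (-(l * (p.rate * p.noise))) *
      expNeg (streetExponent p (fun q t => l * radarExponent p q t) (0, 0)) *
      expNeg (ENNReal.ofReal p.lineIntensity * ∫⁻ q in Ico 0 (2 * Real.pi) ×ˢ Ioi 0,
        (1 - expNegENN (streetExponent p (fun q t => l * radarExponent p q t) q))) := by
  have hφ : Measurable fun x : (ℝ × ℝ) × ℝ => l * radarExponent p x.1 x.2 :=
    (measurable_radarExponent p measurable_fst measurable_snd).const_mul _
  have hXe : Measurable fun ω => detectionExponent p (N.env ω) :=
    (measurable_detectionExponent p).comp hN.measurable_env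
  have hpow (ω : Ω) : expNeg (detectionExponent p (N.env ω)) ^ l =
      (expNegENN (l * detectionExponent p (N.env ω))).toReal := by
    rw [expNegENN_nat_mul, ENNReal.toReal_pow, toReal_expNegENN]
  have hexp (ω : Ω) : expNegENN (l * detectionExponent p (N.env ω)) =
      ENNReal.ofReal (Real.exp (-(l * (p.rate * p.noise)))) *
      expNegENN (∑' (k : Option ℕ) (j : ℕ), if N.active k j ω = true then
        l * radarExponent p (streetOf (fun i => N.line i ω) k) (N.pos k j ω) else 0) := by
    have hn : 0 ≤ p.rate * p.noise := mul_nonneg hp.rate_pos.le hp.noise_nonneg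
    rw [detectionExponent, mul_add, expNegENN_add, ← ENNReal.ofReal_natCast l,
      ← ENNReal.ofReal_mul (Nat.cast_nonneg l), expNegENN_ofReal (by positivity),
      ← ENNReal.tsum_mul_left]
    simp_rw [← ENNReal.tsum_mul_left, mul_ite, mul_zero]
    rfl
  have hae := hN.detectionProb_ae_eq hp
  have h1 : N.moment P p l = ∫ ω, (expNegENN (l * detectionExponent p (N.env ω))).toReal ∂P := by
    refine integral_congr_ae ?_
    filter_upwards [hae] with ω hω
    rw [hω, hpow]
  have hXe' : Measurable fun ω => expNegENN (l * detectionExponent p (N.env ω)) :=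
    measurable_expNegENN.comp (hXe.const_mul _)
  rw [h1, integral_toReal hXe'.aemeasurable (.of_forall fun _ => (expNegENN_ne_top _).lt_top)]
  simp_rw [hexp]
  rw [lintegral_const_mul' _ _ ENNReal.ofReal_ne_top,
    hN.lintegral_expNegENN_active (φ := fun q t => l * radarExponent p q t) hp hφ,
    ENNReal.toReal_mul, ENNReal.toReal_mul, toReal_expNegENN, toReal_expNegENN,
    ENNReal.toReal_ofReal (Real.exp_pos _).le, mul_assoc]

end Network

end Network

/-! ### The interference region of a street -/

lemma norm_linePoint (θ r t : ℝ) : ‖linePoint (θ, r) t‖ = Real.sqrt (r ^ 2 + t ^ 2) := by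
  rw [EuclideanSpace.norm_eq]
  congr 1
  simp only [linePoint, Fin.sum_univ_two, Real.norm_eq_abs, sq_abs]
  simp
  linear_combination (r ^ 2 + t ^ 2) * Real.sin_sq_add_cos_sq θ

/-- The two sector conditions in the coordinates `(r, t)` of a point of the line; the two possible
boresights of the radar combine to the absolute value `|t|`. -/
lemma interferes_linePoint_iff (β θ r t : ℝ) :
    Interferes β (θ, r) (linePoint (θ, r) t) ↔
      Real.cos (β / 2) * Real.sqrt (r ^ 2 + t ^ 2) < |t| ∧
        Real.cos (β / 2) * Real.sqrt (r ^ 2 + t ^ 2) < r * Real.sin θ + t * Real.cos θ := by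
  have h1 : inner ℝ (0 - linePoint (θ, r) t) (lineDir (θ, r)) = -t := by
    simp [linePoint, lineDir, PiLp.inner_apply, Fin.sum_univ_two]
    linear_combination -t * Real.sin_sq_add_cos_sq θ
  have h2 : inner ℝ (linePoint (θ, r) t - 0) !₂[(0 : ℝ), 1] =
      r * Real.sin θ + t * Real.cos θ := by
    simp [linePoint, PiLp.inner_apply, Fin.sum_univ_two]
  have hn : ‖0 - linePoint (θ, r) t‖ = Real.sqrt (r ^ 2 + t ^ 2) := by
    rw [zero_sub, norm_neg, norm_linePoint]
  have hn' : ‖linePoint (θ, r) t - 0‖ = Real.sqrt (r ^ 2 + t ^ 2) := by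
    rw [sub_zero, norm_linePoint]
  simp only [Interferes, sector, mem_ofPred_eq, inner_neg_right, h1, h2, hn, hn', neg_neg]
  rw [lt_abs, or_comm]

lemma interferes_egoStreet_iff {β : ℝ} (hβ : 0 < β) (hβ' : β ≤ Real.pi / 2) (t : ℝ) :
    Interferes β (0, 0) (linePoint (0, 0) t) ↔ 0 < t := by
  rw [interferes_linePoint_iff]
  have hc1 : Real.cos (β / 2) < 1 := by
    rw [← Real.cos_zero]
    exact Real.cos_lt_cos_of_nonneg_of_le_pi le_rfl (by linarith [Real.pi_pos]) (by linarith)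
  have hc0 : 0 ≤ Real.cos (β / 2) :=
    Real.cos_nonneg_of_mem_Icc ⟨by linarith [Real.pi_pos], by linarith [Real.pi_pos]⟩
  simp only [Real.sin_zero, Real.cos_zero, mul_zero, zero_add, mul_one, ne_eq, OfNat.ofNat_ne_zero,
    not_false_eq_true, zero_pow, Real.sqrt_sq_eq_abs]
  constructor
  · rintro ⟨-, h⟩
    exact (mul_nonneg hc0 (abs_nonneg t)).trans_lt h
  · intro h
    rw [abs_of_pos h]
    exact ⟨by nlinarith, by nlinarith⟩

/-- A point with coordinates `m` along the axis of a cone and `n` across it lies in the cone. -/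
lemma cos_mul_sqrt_lt_iff {a b m n : ℝ} (ha : 0 < a) (hb : 0 < b) (hab : a ^ 2 + b ^ 2 = 1)
    (hn : 0 ≤ n) : a * Real.sqrt (m ^ 2 + n ^ 2) < m ↔ a * n < b * m := by
  have hsq : Real.sqrt (m ^ 2 + n ^ 2) ^ 2 = m ^ 2 + n ^ 2 := Real.sq_sqrt (by positivity)
  have hs := Real.sqrt_nonneg (m ^ 2 + n ^ 2)
  set s := Real.sqrt (m ^ 2 + n ^ 2)
  have hkey : m ^ 2 - (a * s) ^ 2 = (b * m) ^ 2 - (a * n) ^ 2 := by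
    rw [mul_pow, hsq]
    linear_combination -m ^ 2 * hab
  constructor
  · intro h
    have hm : 0 < m := (mul_nonneg ha.le hs).trans_lt h
    refine lt_of_pow_lt_pow_left₀ 2 (by positivity) ?_
    have := pow_lt_pow_left₀ h (by positivity) two_ne_zero
    linarith
  · intro h
    have hm : 0 < m := pos_of_mul_pos_right ((mul_nonneg ha.le hn).trans_lt h) hb.le
    refine lt_of_pow_lt_pow_left₀ 2 hm.le ?_
    have := pow_lt_pow_left₀ h (by positivity) two_ne_zero
    linarith

/-- The interference region of a street that meets the `y`-axis above the origin. In this lemma and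
the next one `a`, `b` are the cosine and sine of half the beamwidth, `s`, `c` the sine and cosine of
the angle between the street and the `y`-axis. -/
lemma cone_inter_cone_iff_of_pos {a b s c x z : ℝ} (hb : 0 < b) (hba : b ≤ a)
    (hab : a ^ 2 + b ^ 2 = 1) (hs : 0 < s) (hc : 0 ≤ c) (hsc : s ^ 2 + c ^ 2 = 1) (hx : 0 < x) :
    (a * (s * |x|) < b * |x * c + z| ∧ a * (s * |z|) < b * (x + c * z)) ↔
      x * (s * a - c * b) < b * z ∧ (0 < s * a - c * b → z * (s * a - c * b) < x * b) := by
  have ha : 0 < a := hb.trans_le hba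
  have hc1 : c ≤ 1 := by nlinarith
  -- the product of `sin (ψ - β)` and `sin (ψ + β)`
  have hprod : (s * a - c * b) * (s * a + c * b) = s ^ 2 - b ^ 2 := by
    linear_combination s ^ 2 * hab - b ^ 2 * hsc
  have hplus : 0 < s * a + c * b := by positivity
  have hplus_ge : b ≤ s * a + c * b := by
    have h1 : 1 ≤ s + c := by nlinarith
    nlinarith
  have habs : a * (s * |z|) < b * (x + c * z) ↔
      z * (s * a - c * b) < x * b ∧ -z * (s * a + c * b) < x * b := by
    rcases abs_cases z with ⟨h, hz⟩ | ⟨h, hz⟩ <;> rw [h]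
    · constructor
      · intro h1
        exact ⟨by linarith, by nlinarith⟩
      · rintro ⟨h1, -⟩
        linarith
    · constructor
      · intro h1
        refine ⟨?_, by linarith⟩
        have : z * (s * a) < 0 := mul_neg_of_neg_of_pos hz (by positivity)
        linarith
      · rintro ⟨-, h1⟩
        linarith
  rw [habs, abs_of_pos hx]
  constructor
  · rintro ⟨h1, h2, h3⟩
    refine ⟨?_, fun _ => h2⟩
    rcases abs_cases (x * c + z) with ⟨h, -⟩ | ⟨h, -⟩ <;> rw [h] at h1
    · linarith
    · -- The cone behind the street direction misses the cone about the `y`-axis: otherwise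
      -- `sin (ψ + β) < sin β`, against `ψ + β ≤ π - β`.
      exfalso
      have h4 : x * (s * a + c * b) < b * -z := by linarith
      have h5 : x * (s * a + c * b) * (s * a + c * b) < b * (x * b) := by
        nlinarith [mul_lt_mul_of_pos_right h4 hplus, mul_lt_mul_of_pos_left h3 hb]
      have h6 : b * b ≤ (s * a + c * b) * (s * a + c * b) :=
        mul_le_mul hplus_ge hplus_ge hb.le hplus.le
      nlinarith [mul_le_mul_of_nonneg_left h6 hx.le]
  · rintro ⟨h1, h2⟩
    refine ⟨?_, ?_, ?_⟩
    · have := mul_le_mul_of_nonneg_left (le_abs_self (x * c + z)) hb.le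
      linarith
    · rcases lt_or_ge 0 (s * a - c * b) with h | h
      · exact h2 h
      · rcases le_or_gt 0 z with hz | hz
        · exact (mul_nonpos_of_nonneg_of_nonpos hz h).trans_lt (by positivity)
        · have h3 : c * b - s * a < b := by nlinarith [mul_pos hs ha]
          have h4 : b * (z * (s * a - c * b)) ≤ x * (s * a - c * b) * (s * a - c * b) := by
            nlinarith [mul_le_mul_of_nonneg_right h1.le (neg_nonneg.2 h)]
          have h5 : (s * a - c * b) * (s * a - c * b) < b * b := by nlinarith
          have h6 : b * (z * (s * a - c * b)) < b * (x * b) := by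
            nlinarith [mul_lt_mul_of_pos_left h5 hx]
          exact lt_of_mul_lt_mul_left h6 hb.le
    · rcases le_or_gt 0 z with hz | hz
      · have h3 : -z * (s * a + c * b) ≤ 0 :=
          mul_nonpos_of_nonpos_of_nonneg (neg_nonpos.2 hz) hplus.le
        exact h3.trans_lt (by positivity)
      · have h3 := mul_lt_mul_of_pos_right h1 hplus
        have h4 : b * (-z * (s * a + c * b)) < b * (x * b) := by
          have h5 : x * (s * a - c * b) * (s * a + c * b) = x * (s ^ 2 - b ^ 2) := by
            rw [mul_assoc, hprod]
          nlinarith [mul_pos hx (pow_pos hs 2)]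
        exact lt_of_mul_lt_mul_left h4 hb.le

/-- The interference region of a street that meets the `y`-axis below the origin. -/
lemma cone_inter_cone_iff_of_neg {a b s c x z : ℝ} (ha : 0 < a) (hb : 0 < b)
    (hab : a ^ 2 + b ^ 2 = 1) (hs : 0 < s) (hc : 0 ≤ c) (hsc : s ^ 2 + c ^ 2 = 1) (hx : x < 0) :
    (a * (s * |x|) < b * |x * c + z| ∧ a * (s * |z|) < b * (x + c * z)) ↔
      s * a - c * b < 0 ∧ z * (s * a - c * b) < x * b := by
  have hprod : (s * a - c * b) * (s * a + c * b) = s ^ 2 - b ^ 2 := by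
    linear_combination s ^ 2 * hab - b ^ 2 * hsc
  have hplus : 0 < s * a + c * b := by positivity
  have hsa : 0 < s * a := by positivity
  rw [abs_of_neg hx]
  constructor
  · rintro ⟨-, h2⟩
    have hz : 0 < z := by
      by_contra hz
      have h3 : 0 ≤ a * (s * |z|) := by positivity
      have h4 : b * (c * z) ≤ 0 :=
        mul_nonpos_of_nonneg_of_nonpos hb.le (mul_nonpos_of_nonneg_of_nonpos hc (not_lt.1 hz))
      nlinarith [mul_neg_of_neg_of_pos hx hb]
    rw [abs_of_pos hz] at h2
    have h5 : z * (s * a - c * b) < x * b := by linarith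
    refine ⟨?_, h5⟩
    by_contra h6
    have := mul_nonneg hz.le (not_lt.1 h6)
    nlinarith [mul_neg_of_neg_of_pos hx hb]
  · rintro ⟨h1, h2⟩
    have hz : 0 < z := by
      by_contra hz
      have := mul_nonneg_of_nonpos_of_nonpos (not_lt.1 hz) h1.le
      nlinarith [mul_neg_of_neg_of_pos hx hb]
    rw [abs_of_pos hz]
    refine ⟨?_, by linarith⟩
    have h3 : -x * (s * a + c * b) < b * z := by
      have h4 : -(s * a - c * b) * (-x * (s * a + c * b)) < -(s * a - c * b) * (b * z) := by
        have h5 : -(s * a - c * b) * (-x * (s * a + c * b)) = x * (s ^ 2 - b ^ 2) := by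
          rw [← hprod]; ring
        rw [h5]
        nlinarith [mul_lt_mul_of_pos_left h2 hb, mul_neg_of_neg_of_pos hx (pow_pos hs 2)]
      exact lt_of_mul_lt_mul_left h4 (by linarith)
    have := mul_le_mul_of_nonneg_left (le_abs_self (x * c + z)) hb.le
    linarith

lemma sin_acuteAngle (θ : ℝ) : Real.sin (acuteAngle θ) = |Real.sin θ| :=
  Real.sin_arcsin (by linarith [abs_nonneg (Real.sin θ)]) (Real.abs_sin_le_one θ)

lemma cos_acuteAngle (θ : ℝ) : Real.cos (acuteAngle θ) = |Real.cos θ| := by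
  rw [acuteAngle, Real.cos_arcsin, sq_abs, ← Real.cos_sq', Real.sqrt_sq_eq_abs]

/-- The interference interval is the intersection of the two conditions on the angles. -/
lemma mem_interferenceInterval_iff {β θ r z : ℝ} (hβ : 0 < β) (hβ' : β ≤ Real.pi / 2)
    (hθ : Real.sin θ ≠ 0) (hr : 0 < r) :
    z ∈ interferenceInterval β θ r ↔
      Real.cos (β / 2) * (|Real.sin θ| * |crossing θ r|) <
          Real.sin (β / 2) * |crossing θ r * |Real.cos θ| + z| ∧
        Real.cos (β / 2) * (|Real.sin θ| * |z|) <
          Real.sin (β / 2) * (crossing θ r + |Real.cos θ| * z) := by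
  have hpi := Real.pi_pos
  have hb : 0 < Real.sin (β / 2) := Real.sin_pos_of_pos_of_lt_pi (by linarith) (by linarith)
  have hba : Real.sin (β / 2) ≤ Real.cos (β / 2) := by
    rw [← Real.cos_pi_div_two_sub]
    exact Real.cos_le_cos_of_nonneg_of_le_pi (by linarith) (by linarith) (by linarith)
  have ha := hb.trans_le hba
  have hab : Real.cos (β / 2) ^ 2 + Real.sin (β / 2) ^ 2 = 1 := Real.cos_sq_add_sin_sq _
  have hs : 0 < |Real.sin θ| := abs_pos.2 hθ
  have hc := abs_nonneg (Real.cos θ)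
  have hsc : |Real.sin θ| ^ 2 + |Real.cos θ| ^ 2 = 1 := by
    rw [sq_abs, sq_abs]; exact Real.sin_sq_add_cos_sq θ
  -- The comparisons of `acuteAngle θ` with `β / 2` are signs of `sin (acuteAngle θ - β / 2)`.
  have hS : Real.sin (acuteAngle θ - β / 2) =
      |Real.sin θ| * Real.cos (β / 2) - |Real.cos θ| * Real.sin (β / 2) := by
    rw [Real.sin_sub, sin_acuteAngle, cos_acuteAngle]
  have hψ0 : 0 ≤ acuteAngle θ := Real.arcsin_nonneg.2 hs.le
  have hψ1 : acuteAngle θ ≤ Real.pi / 2 := Real.arcsin_le_pi_div_two _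
  have hlt : β / 2 < acuteAngle θ ↔ 0 < Real.sin (acuteAngle θ - β / 2) := by
    constructor
    · exact fun h => Real.sin_pos_of_pos_of_lt_pi (by linarith) (by linarith)
    · intro h
      by_contra h'
      exact h.not_ge (Real.sin_nonpos_of_nonpos_of_neg_pi_le (by linarith) (by linarith))
  have hgt : acuteAngle θ < β / 2 ↔ Real.sin (acuteAngle θ - β / 2) < 0 := by
    constructor
    · exact fun h => Real.sin_neg_of_neg_of_neg_pi_lt (by linarith) (by linarith)
    · intro h
      by_contra h'
      exact h.not_ge (Real.sin_nonneg_of_nonneg_of_le_pi (by linarith) (by linarith))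
  have hx0 : crossing θ r ≠ 0 := div_ne_zero hr.ne' hθ
  simp only [interferenceInterval, mem_ofPred_eq, lowerEnd, upperEnd, hlt, hgt]
  rcases lt_or_gt_of_ne hx0 with hx | hx
  · rw [cone_inter_cone_iff_of_neg ha hb hab hs hc hsc hx, ← hS]
    simp only [hx.not_gt, if_false, false_and, EReal.coe_lt_top, and_true]
    split_ifs with h
    · rw [EReal.coe_lt_coe_iff, div_lt_iff_of_neg h]
      exact (and_iff_right h).symm
    · simp [h]
  · rw [cone_inter_cone_iff_of_pos hb hba hab hs hc hsc hx, ← hS]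
    simp only [hx, if_true, true_and, EReal.coe_lt_coe_iff]
    rw [div_lt_iff₀ hb, mul_comm z]
    refine and_congr_right fun _ => ?_
    split_ifs with h
    · rw [EReal.coe_lt_coe_iff, lt_div_iff₀ h]
      exact ⟨fun h' _ => h', fun h' => h' h⟩
    · simp [h]

/-- The two conditions in the coordinate `z` on the line, measured upwards from the `y`-axis;
`t = σ (x |cos θ| + z)` is the signed distance from the foot of the normal. -/
lemma interferes_iff_mem_interferenceInterval {β θ r z σ : ℝ} (hβ : 0 < β)
    (hβ' : β ≤ Real.pi / 2) (hθ : Real.sin θ ≠ 0) (hr : 0 < r) (hσ : |σ| = 1)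
    (hσc : σ * Real.cos θ = |Real.cos θ|) :
    Interferes β (θ, r) (linePoint (θ, r) (σ * (crossing θ r * |Real.cos θ| + z))) ↔
      z ∈ interferenceInterval β θ r := by
  have hpi := Real.pi_pos
  have hb : 0 < Real.sin (β / 2) := Real.sin_pos_of_pos_of_lt_pi (by linarith) (by linarith)
  have ha : 0 < Real.cos (β / 2) := Real.cos_pos_of_mem_Ioo ⟨by linarith, by linarith⟩
  have hab : Real.cos (β / 2) ^ 2 + Real.sin (β / 2) ^ 2 = 1 := Real.cos_sq_add_sin_sq _
  rw [mem_interferenceInterval_iff hβ hβ' hθ hr, interferes_linePoint_iff]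
  have hrx : r = crossing θ r * Real.sin θ := by rw [crossing, div_mul_cancel₀ _ hθ]
  have hσ2 : σ ^ 2 = 1 := by rw [← sq_abs, hσ, one_pow]
  set x := crossing θ r
  set c := |Real.cos θ| with hc_def
  have hsc : Real.sin θ ^ 2 + c ^ 2 = 1 := by rw [hc_def, sq_abs]; exact Real.sin_sq_add_cos_sq θ
  have hy : r * Real.sin θ + σ * (x * c + z) * Real.cos θ = x + c * z := by
    rw [hrx]
    linear_combination (x * c + z) * hσc + x * hsc
  have hQ1 : r ^ 2 + (σ * (x * c + z)) ^ 2 = |x * c + z| ^ 2 + (|Real.sin θ| * |x|) ^ 2 := by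
    rw [hrx, mul_pow, mul_pow σ, hσ2, mul_pow |Real.sin θ|, sq_abs, sq_abs, sq_abs]
    ring
  have hQ2 : r ^ 2 + (σ * (x * c + z)) ^ 2 = (x + c * z) ^ 2 + (|Real.sin θ| * |z|) ^ 2 := by
    rw [hrx, mul_pow, mul_pow σ, hσ2, mul_pow |Real.sin θ|, sq_abs, sq_abs]
    linear_combination (x ^ 2 - z ^ 2) * hsc
  rw [hy, abs_mul, hσ, one_mul]
  refine and_congr ?_ ?_
  · rw [hQ1, cos_mul_sqrt_lt_iff ha hb hab (by positivity)]
  · rw [hQ2, cos_mul_sqrt_lt_iff ha hb hab (by positivity)]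

lemma norm_linePoint_eq_pointDist {θ r z σ : ℝ} (hθ : Real.sin θ ≠ 0) (hσ : |σ| = 1) :
    ‖linePoint (θ, r) (σ * (crossing θ r * |Real.cos θ| + z))‖ =
      pointDist (crossing θ r) z θ := by
  have hrx : r = crossing θ r * Real.sin θ := by rw [crossing, div_mul_cancel₀ _ hθ]
  have hσ2 : σ ^ 2 = 1 := by rw [← sq_abs, hσ, one_pow]
  rw [norm_linePoint, pointDist, mul_pow, hσ2]
  congr 1
  conv_lhs => rw [hrx]
  have hsc : Real.sin θ ^ 2 + |Real.cos θ| ^ 2 = 1 := by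
    rw [sq_abs]; exact Real.sin_sq_add_cos_sq θ
  have hcr : crossing θ (crossing θ r * Real.sin θ) = crossing θ r := by rw [← hrx]
  rw [hcr]
  linear_combination crossing θ r ^ 2 * hsc

lemma measurableSet_interferenceInterval (β θ r : ℝ) :
    MeasurableSet (interferenceInterval β θ r) :=
  (measurableSet_lt measurable_const measurable_coe_real_ereal).inter
    (measurableSet_lt measurable_coe_real_ereal measurable_const)

/-! ### The exponent of a street -/

open Classical in
/-- The factor of an active radar, to the power `l`, is `transmission ^ l` if it interferes. -/
lemma one_sub_expNegENN_radarExponent {p : Params} (hp : p.Admissible) (l : ℕ) (q : ℝ × ℝ)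
    (t : ℝ) : 1 - expNegENN (l * radarExponent p q t) =
      if Interferes p.beamwidth q (linePoint q t) then
        ENNReal.ofReal (1 - transmission p ‖linePoint q t‖ ^ l) else 0 := by
  rw [expNegENN_nat_mul, radarExponent,
    expNegENN_negLog (ENNReal.inv_le_one.2 le_self_add), pathGain]
  split_ifs with h
  · have hne : linePoint q t ≠ 0 := by
      intro h0
      have := h.2
      simp [sector, h0] at this
    have hρ : 0 < ‖linePoint q t‖ := norm_pos_iff.2 hne
    set ρ := ‖linePoint q t‖
    have hκ := hp.crossGain_pos
    have hg := hp.gain_pos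
    have hP := hp.power_pos
    have hm := hp.meanRCS_pos
    have hγ := hp.threshold_pos
    have hR : 0 < p.R ^ (-2 * p.α) := Real.rpow_pos_of_pos hp.R_pos _
    have hρα : 0 < ρ ^ (-p.α) := Real.rpow_pos_of_pos hρ _
    have hrate := hp.rate_pos
    have hT : transmission p ρ =
        (1 + p.rate * (p.crossGain * p.gain * p.power * ρ ^ (-p.α)))⁻¹ := by
      rw [transmission, Params.rate, Params.signal]
      generalize p.R ^ (-2 * p.α) = u at hR
      generalize ρ ^ (-p.α) = v at hρα
      field_simp
    have hy : 0 < p.rate * (p.crossGain * p.gain * p.power * ρ ^ (-p.α)) := by positivity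
    rw [ENNReal.ofReal_rpow_of_pos hρ, ← ENNReal.ofReal_mul (by positivity),
      ← ENNReal.ofReal_mul hrate.le, ← ENNReal.ofReal_one, ← ENNReal.ofReal_add zero_le_one hy.le,
      ← ENNReal.ofReal_inv_of_pos (by positivity), ← hT]
    have hT0 : 0 ≤ transmission p ρ := by rw [hT]; positivity
    rw [← ENNReal.ofReal_pow hT0, ← ENNReal.ofReal_sub _ (by positivity)]
  · simp

lemma streetExponent_egoStreet {p : Params} (hp : p.Admissible) (l : ℕ) :
    streetExponent p (fun q t => l * radarExponent p q t) (0, 0) =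
      ENNReal.ofReal (p.access * p.vehicleIntensity) *
        ∫⁻ z in Ioi (0 : ℝ), ENNReal.ofReal (1 - transmission p z ^ l) := by
  classical
  rw [streetExponent, ← lintegral_indicator measurableSet_Ioi]
  congr 1
  refine lintegral_congr fun t => ?_
  rw [one_sub_expNegENN_radarExponent hp]
  by_cases ht : 0 < t
  · rw [if_pos ((interferes_egoStreet_iff hp.beamwidth_mem.1 hp.beamwidth_mem.2 t).2 ht),
      indicator_of_mem (mem_Ioi.2 ht), norm_linePoint]
    simp [Real.sqrt_sq ht.le]
  · rw [if_neg fun h =>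
      ht ((interferes_egoStreet_iff hp.beamwidth_mem.1 hp.beamwidth_mem.2 t).1 h),
      indicator_of_notMem (by simpa using ht)]

lemma lintegral_comp_mul_add {σ : ℝ} (hσ : |σ| = 1) (m : ℝ) (F : ℝ → ℝ≥0∞) :
    ∫⁻ z, F (σ * (m + z)) = ∫⁻ t, F t := by
  rcases eq_or_eq_neg_of_abs_eq hσ with rfl | rfl
  · simp_rw [one_mul]
    exact lintegral_add_left_eq_self F m
  · simp_rw [neg_one_mul]
    rw [lintegral_add_left_eq_self (fun t => F (-t)) m]
    exact lintegral_neg_eq_self F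

/-- The exponent of a street that is not parallel to the `y`-axis, in the coordinate measured upwards
from the `y`-axis. -/
lemma streetExponent_line {p : Params} (hp : p.Admissible) (l : ℕ) {θ r : ℝ}
    (hθ : Real.sin θ ≠ 0) (hr : 0 < r) :
    streetExponent p (fun q t => l * radarExponent p q t) (θ, r) =
      ENNReal.ofReal (p.access * p.vehicleIntensity) *
        ∫⁻ z in interferenceInterval p.beamwidth θ r,
          ENNReal.ofReal (1 - transmission p (pointDist (crossing θ r) z θ) ^ l) := by
  classical
  obtain ⟨σ, hσ, hσc⟩ : ∃ σ : ℝ, |σ| = 1 ∧ σ * Real.cos θ = |Real.cos θ| := by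
    rcases abs_cases (Real.cos θ) with ⟨h, -⟩ | ⟨h, -⟩
    · exact ⟨1, by simp, by simp [h]⟩
    · exact ⟨-1, by simp, by simp [h]⟩
  rw [streetExponent, ← lintegral_indicator (measurableSet_interferenceInterval _ _ _),
    ← lintegral_comp_mul_add hσ (crossing θ r * |Real.cos θ|)]
  congr 1
  refine lintegral_congr fun z => ?_
  have hiff := interferes_iff_mem_interferenceInterval (z := z) hp.beamwidth_mem.1
    hp.beamwidth_mem.2 hθ hr hσ hσc
  rw [one_sub_expNegENN_radarExponent hp, norm_linePoint_eq_pointDist hθ hσ]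
  by_cases hz : z ∈ interferenceInterval p.beamwidth θ r
  · rw [if_pos (hiff.2 hz), indicator_of_mem hz]
  · rw [if_neg fun h => hz (hiff.1 h), indicator_of_notMem hz]

/-- Lines parallel to the `y`-axis have measure zero. -/
lemma ae_sin_ne_zero : ∀ᵐ θ : ℝ, Real.sin θ ≠ 0 := by
  have h : {θ : ℝ | Real.sin θ = 0} = range fun n : ℤ => (n : ℝ) * Real.pi := by
    ext θ
    exact Real.sin_eq_zero_iff
  have hnull : volume {θ : ℝ | Real.sin θ = 0} = 0 := by
    rw [h]
    exact (countable_range _).measure_zero _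
  exact measure_eq_zero_iff_ae_notMem.1 hnull

end RadarNetwork

end

open RadarNetwork in
theorem mainTheorem3 {Ω : Type*} [MeasurableSpace Ω] (P : MeasureTheory.Measure Ω)
    [MeasureTheory.IsProbabilityMeasure P] (p : RadarNetwork.Params) (hp : p.Admissible)
    (N : RadarNetwork.Network Ω) (hN : N.HasNetworkLaw P p) (l : ℕ) :
    N.moment P p l =
      Real.exp (-(l * (p.threshold * p.noise) /
          (p.gain * p.power * p.meanRCS * p.R ^ (-2 * p.α)))) *
      RadarNetwork.expNeg (ENNReal.ofReal (p.access * p.vehicleIntensity) *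
        ∫⁻ z in Set.Ioi (0 : ℝ), ENNReal.ofReal (1 - RadarNetwork.transmission p z ^ l)) *
      RadarNetwork.expNeg (ENNReal.ofReal p.lineIntensity *
        ∫⁻ θ in Set.Ico (0 : ℝ) (2 * Real.pi), ∫⁻ r in Set.Ioi (0 : ℝ),
          ENNReal.ofReal (1 - RadarNetwork.expNeg
            (ENNReal.ofReal (p.access * p.vehicleIntensity) *
              ∫⁻ z in RadarNetwork.interferenceInterval p.beamwidth θ r,
                ENNReal.ofReal (1 - RadarNetwork.transmission p
                  (RadarNetwork.pointDist (RadarNetwork.crossing θ r) z θ) ^ l)))) := by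
  have hS := measurable_streetExponent p (φ := fun q t => l * radarExponent p q t)
    ((measurable_radarExponent p measurable_fst measurable_snd).const_mul _)
  have hH : Measurable fun q => 1 - expNegENN
      (streetExponent p (fun q t => l * radarExponent p q t) q) := by fun_prop
  have hrate : l * (p.rate * p.noise) = l * (p.threshold * p.noise) /
      (p.gain * p.power * p.meanRCS * p.R ^ (-2 * p.α)) := by
    rw [Params.rate, Params.signal]
    ring
  rw [hN.moment_eq hp, streetExponent_egoStreet hp, hrate, Measure.volume_eq_prod,
    ← Measure.prod_restrict, lintegral_prod _ hH.aemeasurable]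
  congr 3
  refine lintegral_congr_ae ?_
  filter_upwards [ae_restrict_of_ae ae_sin_ne_zero] with θ hθ
  refine setLIntegral_congr_fun measurableSet_Ioi fun r hr => ?_
  simp only [streetExponent_line hp l hθ hr, expNegENN_eq_ofReal]
  rw [ENNReal.ofReal_sub _ (expNeg_nonneg _), ENNReal.ofReal_one]
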